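/- All matroids are finite. For a matroid $M$ on $E=E(M)$ with rank function $r$, put $r(M)=r(E)$, let $\eta(X)=|X|-r(X)$ be the nullity of $X\subseteq E$, and let $m=\eta(E)$. A matroid is connected if any two distinct elements lie in a common circuit. A flat $X$ is connected if $M|X$ is connected, nontrivial if it is not independent, and proper if $X\neq E$. A connected flat $X$ of a connected matroid $M$ with $|X|>1$ and $r(X)<r(M)$ is a fundamental flat if $X\cap C$ is a basis of $X$ for some spanning circuit $C$ of $M$. For lattice paths $P,Q$ from $(0,0)$ to $(m',r')$ with East steps $(1,0)$ and North steps $(0,1)$, where $P$ never goes above $Q$, let $N_i$ ($1\le i\le r'$) be the set of all $j$ such that step $j$ is the $i$-th North step of some lattice path from $(0,0)$ to $(m',r')$ that goes neither above $Q$ nor below $P$. Let $M[P,Q]$ be the transversal matroid on $\{1,\dots,m'+r'\}$ with presentation $(N_1,\dots,N_{r'})$, that is, the independent sets are the partial transversals of this family. A lattice path matroid is a matroid isomorphic to some $M[P,Q]$. **Theorem.** A connected matroid $M$ is a lattice path matroid if and only if there are (possibly empty) chains $F_1\subsetneq\cdots\subsetneq F_h$ and $G_1\subsetneq\cdots\subsetneq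 G_k$ of subsets of $E$ such that (i) the two chains have no member in common, and the fundamental flats of $M$ are exactly the sets $F_1,\dots,F_h,G_1,\dots,G_k$; (ii) whenever $F_i\cap G_j\neq\emptyset$, $F_i\cup G_j=E$; (iii) the proper nontrivial connected flats of $M$ are exactly the sets $F_1,\dots,F_h,G_1,\dots,G_k$ and those intersections $F_i\cap G_j$ for which $m<\eta(F_i)+\eta(G_j)$; (iv) $r(F_i\cap G_j)=r(F_i)+r(G_j)-r(M)$ for all $i,j$ with $m<\eta(F_i)+\eta(G_j)$. -/

import Mathlib

namespace LPM

open Set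

section Transversal

variable {α ι : Type*}

/-- `I` is a partial transversal of the family `A`: its elements can be matched injectively with
indices `i` of members `A i` that contain them. -/
def IsPartialTransversal (A : ι → Set α) (I : Set α) : Prop :=
  ∃ φ : I → ι, Function.Injective φ ∧ ∀ x : I, (x : α) ∈ A (φ x)

lemma isPartialTransversal_iff [Nonempty ι] (A : ι → Set α) (I : Set α) :
    IsPartialTransversal A I ↔ ∃ φ : α → ι, InjOn φ I ∧ ∀ x ∈ I, x ∈ A (φ x) := by
  classical
  constructor
  · rintro ⟨φ, hφ, hA⟩
    refine ⟨fun x => if h : x ∈ I then φ ⟨x, h⟩ else Classical.arbitrary ι, ?_, ?_⟩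
    · intro x hx y hy hxy
      simp only [hx, hy, dif_pos] at hxy
      exact congrArg Subtype.val (hφ hxy)
    · intro x hx
      simpa [hx] using hA ⟨x, hx⟩
  · rintro ⟨φ, hφ, hA⟩
    exact ⟨fun x => φ x, fun x y h => Subtype.ext (hφ x.2 y.2 h), fun x => hA x x.2⟩

lemma IsPartialTransversal.empty (A : ι → Set α) : IsPartialTransversal A ∅ :=
  ⟨fun x => x.2.elim, fun x => x.2.elim, fun x => x.2.elim⟩

lemma IsPartialTransversal.subset {A : ι → Set α} {I J : Set α}
    (hJ : IsPartialTransversal A J) (h : I ⊆ J) : IsPartialTransversal A I := by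
  obtain ⟨φ, hφ, hA⟩ := hJ
  exact ⟨fun x => φ ⟨x, h x.2⟩, fun x y hxy => Subtype.ext (by simpa using hφ hxy),
    fun x => hA ⟨x, h x.2⟩⟩

lemma IsPartialTransversal.augment {A : ι → Set α} {I J : Set α} (hI : IsPartialTransversal A I)
    (hJ : IsPartialTransversal A J) (hIfin : I.Finite) (hlt : I.ncard < J.ncard) :
    ∃ e ∈ J, e ∉ I ∧ IsPartialTransversal A (insert e I) := by
  classical
  have hJne : J.Nonempty := by
    rw [nonempty_iff_ne_empty]
    rintro rfl
    simp at hlt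
  obtain ⟨e₀, he₀⟩ := hJne
  have : Nonempty ι := ⟨hJ.choose ⟨e₀, he₀⟩⟩
  simp only [isPartialTransversal_iff] at hI hJ ⊢
  obtain ⟨φ, hφ, hφA⟩ := hI
  obtain ⟨ψ, hψ, hψA⟩ := hJ
  induction hn : {x ∈ I | φ x ≠ ψ x}.ncard using Nat.strong_induction_on generalizing φ with
  | _ n ih =>
    obtain ⟨e, heJ, heφ⟩ : ∃ e ∈ J, ψ e ∉ φ '' I := by
      by_contra! hcon
      have h1 : (ψ '' J).ncard ≤ (φ '' I).ncard :=
        ncard_le_ncard (by rintro _ ⟨x, hx, rfl⟩; exact hcon x hx) (hIfin.image φ)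
      rw [hφ.ncard_image, hψ.ncard_image] at h1
      omega
    have hinj : InjOn (Function.update φ e (ψ e)) (insert e I) := by
      intro x hx y hy hxy
      by_cases h1 : x = e <;> by_cases h2 : y = e
      · rw [h1, h2]
      · subst h1
        rw [Function.update_self, Function.update_of_ne h2] at hxy
        exact (heφ ⟨y, hy.resolve_left h2, hxy.symm⟩).elim
      · subst h2
        rw [Function.update_self, Function.update_of_ne h1] at hxy
        exact (heφ ⟨x, hx.resolve_left h1, hxy⟩).elim
      · rw [Function.update_of_ne h1, Function.update_of_ne h2] at hxy
        exact hφ (hx.resolve_left h1) (hy.resolve_left h2) hxy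
    have hmem : ∀ x ∈ insert e I, x ∈ A (Function.update φ e (ψ e) x) := by
      intro x hx
      by_cases h1 : x = e
      · subst h1
        rw [Function.update_self]
        exact hψA x heJ
      · rw [Function.update_of_ne h1]
        exact hφA x (hx.resolve_left h1)
    by_cases heI : e ∈ I
    · refine ih _ ?_ (Function.update φ e (ψ e)) (hinj.mono (subset_insert _ _))
        (fun x hx => hmem x (mem_insert_of_mem _ hx)) rfl
      rw [← hn]
      refine ncard_lt_ncard ⟨?_, ?_⟩ (hIfin.subset (sep_subset _ _))
      · rintro x ⟨hx, hne⟩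
        refine ⟨hx, ?_⟩
        by_cases h1 : x = e
        · subst h1
          simp at hne
        · rwa [Function.update_of_ne h1] at hne
      · intro hsub
        have := hsub (show e ∈ {x ∈ I | φ x ≠ ψ x} from ⟨heI, fun h => heφ ⟨e, heI, h⟩⟩)
        exact this.2 (by simp)
    · exact ⟨e, heJ, heI, _, hinj, hmem⟩

/-- The transversal matroid on the finite ground set `E` presented by the family `A`: its
independent sets are the partial transversals of `A` contained in `E`. -/
def transversalMatroid (E : Set α) (hE : E.Finite) (A : ι → Set α) : Matroid α :=
  (IndepMatroid.ofFinite hE (fun I => I ⊆ E ∧ IsPartialTransversal A I)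
    ⟨empty_subset E, IsPartialTransversal.empty A⟩
    (fun _ _ hJ hIJ => ⟨hIJ.trans hJ.1, hJ.2.subset hIJ⟩)
    (fun _ _ hI hJ hlt => by
      obtain ⟨e, heJ, heI, he⟩ := hI.2.augment hJ.2 (hE.subset hI.1) hlt
      exact ⟨e, heJ, heI, insert_subset (hJ.1 heJ) hI.1, he⟩)
    (fun _ hI => hI.1)).matroid

end Transversal

/-- A step of a lattice path: East is `(1, 0)` and North is `(0, 1)`. -/
inductive Step where
  | east : Step
  | north : Step
deriving DecidableEq

/-- The number of North steps among the first `k` steps of the path `R` that starts at `(0, 0)`.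
After `k` steps (`k` at most the length) the path is at the point `(k - height R k, height R k)`. -/
def height (R : List Step) (k : ℕ) : ℕ := (R.take k).count Step.north

/-- `R` is a lattice path from `(0, 0)` to `(m, r)`. -/
def IsPathTo (m r : ℕ) (R : List Step) : Prop :=
  R.count Step.east = m ∧ R.count Step.north = r

/-- For two paths with the same endpoints: `P` never goes above `Q`. (The two points reached after
`k` steps lie on the same antidiagonal, so it suffices to compare their heights.) -/
def NeverAbove (P Q : List Step) : Prop := ∀ k, height P k ≤ height Q k

/-- Step `j` of `R` (steps are numbered from `1`) is the `i`-th North step of `R`. -/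
def IsNthNorth (R : List Step) (i j : ℕ) : Prop :=
  1 ≤ j ∧ R[j - 1]? = some Step.north ∧ height R j = i

/-- The set `N_i` of all `j` such that step `j` is the `i`-th North step of some lattice path from
`(0, 0)` to `(m, r)` that goes neither above `Q` nor below `P`. -/
def northSet (m r : ℕ) (P Q : List Step) (i : ℕ) : Set ℕ :=
  {j | ∃ R : List Step, IsPathTo m r R ∧ NeverAbove P R ∧ NeverAbove R Q ∧ IsNthNorth R i j}

/-- The matroid `M[P, Q]` for paths `P`, `Q` from `(0, 0)` to `(m, r)`: the transversal matroid on
`{1, …, m + r}` presented by `(N_1, …, N_r)`. -/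
def pathMatroid (m r : ℕ) (P Q : List Step) : Matroid ℕ :=
  transversalMatroid (Icc 1 (m + r)) (finite_Icc 1 (m + r))
    (fun i : Fin r => northSet m r P Q (i + 1))

section Matroid

variable {α : Type*}

/-- A lattice path matroid is a matroid isomorphic to some `M[P, Q]`, where `P` and `Q` are lattice
paths with the same endpoints and `P` never goes above `Q`. -/
def IsLatticePathMatroid (M : Matroid α) : Prop :=
  ∃ (m r : ℕ) (P Q : List Step), IsPathTo m r P ∧ IsPathTo m r Q ∧ NeverAbove P Q ∧
    ∃ (f : α → ℕ) (hf : InjOn f M.E), M.map f hf = pathMatroid m r P Q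

/-- A matroid is connected if any two distinct elements lie in a common circuit. -/
def IsConnected (M : Matroid α) : Prop :=
  ∀ e ∈ M.E, ∀ f ∈ M.E, e ≠ f → ∃ C, M.IsCircuit C ∧ e ∈ C ∧ f ∈ C

/-- The rank of a set in a matroid (used for finite matroids). -/
noncomputable def rk (M : Matroid α) (X : Set α) : ℤ := ((M.eRk X).toNat : ℤ)

/-- The nullity `|X| - r(X)` of a set in a matroid (used for finite matroids). -/
noncomputable def nullity (M : Matroid α) (X : Set α) : ℤ := (X.ncard : ℤ) - rk M X

/-- A connected flat: a flat `X` such that the restriction of `M` to `X` is connected. -/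
def IsConnectedFlat (M : Matroid α) (X : Set α) : Prop :=
  M.IsFlat X ∧ IsConnected (M.restrict X)

/-- A fundamental flat (of a connected matroid `M`): a connected flat `X` with `|X| > 1` and
`r(X) < r(M)` such that `X ∩ C` is a basis of `X` for some spanning circuit `C` of `M`. -/
def IsFundamentalFlat (M : Matroid α) (X : Set α) : Prop :=
  IsConnectedFlat M X ∧ 1 < X.ncard ∧ rk M X < rk M M.E ∧
    ∃ C, M.IsCircuit C ∧ M.Spanning C ∧ M.IsBasis (X ∩ C) X

/-- A proper nontrivial connected flat: a connected flat other than `E(M)` that is not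
independent. -/
def IsProperNontrivialConnectedFlat (M : Matroid α) (X : Set α) : Prop :=
  IsConnectedFlat M X ∧ X ≠ M.E ∧ ¬ M.Indep X

end Matroid

end LPM

namespace LPM

open Set Matroid

variable {α : Type*}

/-! Let `p k` and `q k` be the heights of the lower and upper bounding paths after `k` steps. By a
Hall-type argument a set is independent exactly when every window `{a + 1, …, b}` contains at most
`q b - p a` of its elements. `PathRep` records this description, and all later arguments about
lattice path matroids use only it.

From paths to chains: a circuit violates the window condition by exactly one, and connectedness
means that the two paths meet only at their ends. Hence the proper nontrivial connected flats are
the proper dependent windows whose left end is 0 or a North-East corner of the lower path, and whose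
right end is `n` or an East-North corner of the upper path (`exists_corners`,
`Corners.isConnectedFlat`). Such a window is fundamental exactly when it touches an end of the
ground set: initial windows form one chain, final windows the other. Every other window is an
intersection of one of each, and the rank formula `q b - p a` turns dependence of that window into
the nullity inequality of (iii) and yields (iv).

From chains to paths: by (ii) the sets `F i` and the complements of the `G j` form a single chain,
so the ground set can be numbered with each `F i` initial and each `G j` final. Ranks of initial
segments define `q`, ranks of final segments define `p`. Submodularity makes the window condition
necessary. It is sufficient because the closure of a nonspanning circuit is a proper nontrivial
connected flat (`indep_of_forall_ncard_le`), and by (iii) and (iv) each such flat is a window whose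
rank is the window bound. -/

/-! ### Lattice paths and their height functions. -/

lemma height_zero (R : List Step) : height R 0 = 0 := by simp [height]

lemma height_succ (R : List Step) (k : ℕ) :
    height R (k + 1) = height R k + if R[k]? = some Step.north then 1 else 0 := by
  rw [height, List.take_add_one, List.count_append, ← height]
  rcases R[k]? with _ | (_ | _) <;> simp

lemma IsPathTo.length_eq {m r : ℕ} {R : List Step} (h : IsPathTo m r R) : R.length = m + r := by
  obtain ⟨h1, h2⟩ := h
  subst h1 h2
  induction R with
  | nil => simp
  | cons a t ih => rcases a with _ | _ <;> simp [ih] <;> omega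

lemma IsPathTo.height_of_le {m r k : ℕ} {R : List Step} (h : IsPathTo m r R) (hk : m + r ≤ k) :
    height R k = r := by
  rw [height, List.take_of_length_le (h.length_eq ▸ hk), h.2]

lemma height_mono (R : List Step) : Monotone (height R) :=
  monotone_nat_of_le_succ fun k => by rw [height_succ]; omega

lemma height_succ_le (R : List Step) (k : ℕ) : height R (k + 1) ≤ height R k + 1 := by
  rw [height_succ]; split_ifs <;> omega

/-- The lattice path with `n` steps whose North steps are those at which `g` increases. -/
def pathOf (g : ℕ → ℕ) (n : ℕ) : List Step :=
  (List.range n).map fun k => if g k < g (k + 1) then Step.north else Step.east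

lemma pathOf_getElem? (g : ℕ → ℕ) {n k : ℕ} (hk : k < n) :
    (pathOf g n)[k]? = some (if g k < g (k + 1) then Step.north else Step.east) := by
  simp [pathOf, hk]

lemma height_pathOf {g : ℕ → ℕ} {n : ℕ} (h0 : g 0 = 0)
    (hg : ∀ k < n, g k ≤ g (k + 1) ∧ g (k + 1) ≤ g k + 1) {k : ℕ} (hk : k ≤ n) :
    height (pathOf g n) k = g k := by
  induction k with
  | zero => rw [height_zero, h0]
  | succ k ih =>
    rw [height_succ, ih (by omega), pathOf_getElem? g hk]
    have := hg k hk
    by_cases h : g k < g (k + 1) <;> simp [h] <;> omega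

lemma isPathTo_pathOf {g : ℕ → ℕ} {m r : ℕ} (h0 : g 0 = 0) (hr : g (m + r) = r)
    (hg : ∀ k < m + r, g k ≤ g (k + 1) ∧ g (k + 1) ≤ g k + 1) :
    IsPathTo m r (pathOf g (m + r)) := by
  have hlen : (pathOf g (m + r)).length = m + r := by simp [pathOf]
  have hc : (pathOf g (m + r)).count Step.north = r := by
    have := height_pathOf h0 hg le_rfl
    rwa [height, List.take_of_length_le hlen.le, hr] at this
  have := IsPathTo.length_eq (R := pathOf g (m + r)) ⟨rfl, rfl⟩
  exact ⟨by omega, hc⟩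

/-! ### Hall's condition for the intervals `N_i`. -/

lemma mem_northSet_iff {m r : ℕ} {P Q : List Step} (hP : IsPathTo m r P) (hQ : IsPathTo m r Q)
    (hPQ : NeverAbove P Q) {i j : ℕ} :
    j ∈ northSet m r P Q i ↔ (1 ≤ j ∧ j ≤ m + r) ∧ height P (j - 1) < i ∧ i ≤ height Q j := by
  constructor
  · rintro ⟨R, hR, hPR, hRQ, hj, hN, hi⟩
    obtain ⟨j, rfl⟩ : ∃ t, j = t + 1 := ⟨j - 1, by omega⟩
    simp only [Nat.add_sub_cancel] at *
    have hlt : j < R.length := (List.getElem?_eq_some_iff.1 hN).1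
    rw [hR.length_eq] at hlt
    have h1 := height_succ R j
    rw [if_pos hN] at h1
    have h2 := hPR j
    have h3 := hRQ (j + 1)
    omega
  · rintro ⟨⟨hj, hjn⟩, h1, h2⟩
    obtain ⟨j, rfl⟩ : ∃ t, j = t + 1 := ⟨j - 1, by omega⟩
    simp only [Nat.add_sub_cancel] at *
    -- Follow `Q`, capped at height `i - 1`, through step `j`; step `j + 1` is then the `i`-th North
    -- step, after which the path stays at height `i` until `P` pushes it up.
    let g : ℕ → ℕ := fun k => if k ≤ j then min (height Q k) (i - 1) else max (height P k) i
    have hg0 : g 0 = 0 := by simp [g, height_zero]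
    have hQj := height_succ_le Q j
    have hPj := height_succ_le P j
    have hgr : g (m + r) = r := by
      have := hQ.height_of_le le_rfl
      have := hP.height_of_le le_rfl
      have := height_mono Q hjn
      simp only [g]
      rw [if_neg (by omega)]
      omega
    have hgs : ∀ k < m + r, g k ≤ g (k + 1) ∧ g (k + 1) ≤ g k + 1 := by
      intro k hk
      have hQk := height_succ_le Q k
      have hPk := height_succ_le P k
      have := height_mono Q (Nat.le_succ k)
      have := height_mono P (Nat.le_succ k)
      simp only [g, Nat.succ_eq_add_one] at *
      rcases lt_trichotomy k j with h | h | h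
      · rw [if_pos (by omega), if_pos (by omega)]; omega
      · subst h
        rw [if_pos (by omega), if_neg (by omega)]; omega
      · rw [if_neg (by omega), if_neg (by omega)]; omega
    have hgP : ∀ k, height P k ≤ g k := by
      intro k
      simp only [g]
      split_ifs with h
      · have := hPQ k
        have := height_mono P h
        omega
      · omega
    have hgQ : ∀ k, g k ≤ height Q k := by
      intro k
      simp only [g]
      split_ifs with h
      · omega
      · have := hPQ k
        have := height_mono Q (show j + 1 ≤ k by omega)
        omega
    have hpath := isPathTo_pathOf hg0 hgr hgs
    have hh : ∀ k, k ≤ m + r → height (pathOf g (m + r)) k = g k :=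
      fun k hk => height_pathOf hg0 hgs hk
    have hgj : g j = i - 1 := by simp only [g, le_refl, if_true]; omega
    have hgj' : g (j + 1) = i := by
      simp only [g]; rw [if_neg (by omega)]; omega
    refine ⟨pathOf g (m + r), hpath, ?_, ?_, by omega, ?_, ?_⟩
    · intro k
      rcases le_total k (m + r) with hk | hk
      · rw [hh k hk]; exact hgP k
      · rw [hpath.height_of_le hk, hP.height_of_le hk]
    · intro k
      rcases le_total k (m + r) with hk | hk
      · rw [hh k hk]; exact hgQ k
      · rw [hpath.height_of_le hk, hQ.height_of_le hk]
    · rw [Nat.add_sub_cancel, pathOf_getElem? _ (by omega), if_pos (by omega)]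
    · rw [hh _ hjn, hgj']

/-- Elements of `{a + 1, …, b}` can only be matched to indices above `height P a` and at most
`height Q b`, which bounds their number. Conversely, both ends of the interval `N_i` move right with
`i`, so matching greedily from left to right succeeds when all windows pass. -/
lemma isPartialTransversal_northSet_iff {m r : ℕ} {P Q : List Step} (hP : IsPathTo m r P)
    (hQ : IsPathTo m r Q) (hPQ : NeverAbove P Q) {I : Set ℕ} (hI : I ⊆ Icc 1 (m + r)) :
    IsPartialTransversal (fun i : Fin r => northSet m r P Q (i + 1)) I ↔
      ∀ a b, a < b → b ≤ m + r → (I ∩ Ioc a b).ncard + height P a ≤ height Q b := by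
  constructor
  · rintro ⟨φ, hφ, hA⟩ a b hab hb
    let ψ : ℕ → ℕ := fun x => by
      classical exact if h : x ∈ I then (φ ⟨x, h⟩ : ℕ) else 0
    have hψ : ∀ x (h : x ∈ I), ψ x = φ ⟨x, h⟩ := fun x h => by simp [ψ, h]
    have hmaps : ∀ x ∈ I ∩ Ioc a b, ψ x ∈ Ico (height P a) (height Q b) := by
      rintro x ⟨hx, hax, hxb⟩
      have := (mem_northSet_iff hP hQ hPQ).1 (hA ⟨x, hx⟩)
      have h1 := height_mono P (show a ≤ x - 1 by omega)
      have h2 := height_mono Q hxb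
      rw [hψ x hx]
      simp only [mem_Ico] at *
      omega
    have hinj : InjOn ψ (I ∩ Ioc a b) := by
      intro x hx y hy hxy
      rw [hψ x hx.1, hψ y hy.1] at hxy
      exact congrArg Subtype.val (hφ (Fin.ext hxy))
    have := ncard_le_ncard_of_injOn ψ hmaps hinj (finite_Ico _ _)
    have hc : (Ico (height P a) (height Q b)).ncard = height Q b - height P a := by
      rw [← Finset.coe_Ico, ncard_coe_finset, Nat.card_Ico]
    have h3 := (hPQ a).trans (height_mono Q hab.le)
    omega
  · intro h
    -- On `I` this is the greedy choice in closed form: the least index above `height P (x - 1)` and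
    -- above all indices already used. It counts from 1, hence the later shift by one into `Fin r`.
    let φ : ℕ → ℕ := fun x => (Finset.range x).sup fun a => height P a + (I ∩ Ioc a x).ncard
    have hfin : ∀ a b, (I ∩ Ioc a b).Finite := fun a b => (finite_Ioc a b).inter_of_right I
    have hle : ∀ x a, a < x → height P a + (I ∩ Ioc a x).ncard ≤ φ x := fun x a hax =>
      Finset.le_sup (f := fun a => height P a + (I ∩ Ioc a x).ncard) (Finset.mem_range.2 hax)
    have hub : ∀ x ∈ I, φ x ≤ height Q x := fun x hx => by
      refine Finset.sup_le fun a ha => ?_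
      have := h a x (Finset.mem_range.1 ha) (hI hx).2
      omega
    have hlb : ∀ x ∈ I, height P (x - 1) < φ x := fun x hx => by
      have hx1 := (hI hx).1
      have h1 := hle x (x - 1) (by omega)
      have : 0 < (I ∩ Ioc (x - 1) x).ncard :=
        (ncard_pos (hfin _ _)).2 ⟨x, hx, by simp; omega⟩
      omega
    have hlt : ∀ x ∈ I, ∀ y ∈ I, x < y → φ x < φ y := by
      intro x hx y hy hxy
      have hx1 := (hI hx).1
      rw [Nat.lt_iff_add_one_le]
      obtain ⟨a, ha, hsup⟩ := Finset.exists_mem_eq_sup (Finset.range x) ⟨0, by simp; omega⟩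
        (fun a => height P a + (I ∩ Ioc a x).ncard)
      rw [Finset.mem_range] at ha
      have hsub : insert y (I ∩ Ioc a x) ⊆ I ∩ Ioc a y := by
        rintro z (rfl | ⟨hz, hz1, hz2⟩)
        · exact ⟨hy, by omega, le_rfl⟩
        · exact ⟨hz, hz1, by omega⟩
      have h1 := ncard_le_ncard hsub (hfin _ _)
      rw [ncard_insert_of_notMem (fun hz => by have := hz.2.2; omega) (hfin _ _)] at h1
      have h2 := hle y a (by omega)
      change (Finset.range x).sup _ + 1 ≤ _
      rw [hsup]
      omega
    have hr : ∀ x ∈ I, 1 ≤ φ x ∧ φ x ≤ r := fun x hx => by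
      have h1 := hlb x hx
      have h2 := hub x hx
      have h3 := height_mono Q (hI hx).2
      rw [hQ.height_of_le le_rfl] at h3
      omega
    refine ⟨fun x => ⟨φ x - 1, by have := hr x x.2; omega⟩, ?_, ?_⟩
    · intro x y hxy
      simp only [Fin.mk.injEq] at hxy
      have h1 := hr x x.2
      have h2 := hr y y.2
      have hlt1 := hlt x x.2 y y.2
      have hlt2 := hlt y y.2 x x.2
      refine Subtype.ext ?_
      by_contra hne
      rcases Nat.lt_or_gt_of_ne hne with h | h
      · have := hlt1 h; omega
      · have := hlt2 h; omega
    · intro x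
      have h1 := hr x x.2
      rw [mem_northSet_iff hP hQ hPQ]
      refine ⟨hI x.2, ?_⟩
      have := hlb x x.2
      have := hub x x.2
      simp only
      omega

lemma pathMatroid_indep_iff {m r : ℕ} {P Q : List Step} (hP : IsPathTo m r P)
    (hQ : IsPathTo m r Q) (hPQ : NeverAbove P Q) {I : Set ℕ} (hI : I ⊆ Icc 1 (m + r)) :
    (pathMatroid m r P Q).Indep I ↔
      ∀ a b, a < b → b ≤ m + r → (I ∩ Ioc a b).ncard + height P a ≤ height Q b := by
  rw [← isPartialTransversal_northSet_iff hP hQ hPQ hI]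
  simp only [pathMatroid, transversalMatroid, IndepMatroid.matroid_indep_iff,
    IndepMatroid.ofFinite_indep]
  exact and_iff_right hI

/-- The bijection `f` of the ground set of `M` with `{1, …, n}` identifies `M` with the lattice path
matroid whose lower and upper bounding paths have height functions `p` and `q`. The independent sets
are described by Hall's condition for intervals. -/
structure PathRep (M : Matroid α) (f : α → ℕ) (n : ℕ) (p q : ℕ → ℤ) : Prop where
  bij : BijOn f M.E (Icc 1 n)
  p_zero : p 0 = 0
  q_zero : q 0 = 0
  last : p n = q n
  p_step : ∀ k < n, p k ≤ p (k + 1) ∧ p (k + 1) ≤ p k + 1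
  q_step : ∀ k < n, q k ≤ q (k + 1) ∧ q (k + 1) ≤ q k + 1
  le : ∀ k ≤ n, p k ≤ q k
  indep_iff : ∀ I ⊆ M.E, M.Indep I ↔
    ∀ a b, a < b → b ≤ n → ((I ∩ f ⁻¹' Ioc a b).ncard : ℤ) ≤ q b - p a

lemma ncard_image_inter_eq {f : α → ℕ} {E I : Set α} (hf : InjOn f E) (hI : I ⊆ E) (S : Set ℕ) :
    (f '' I ∩ S).ncard = (I ∩ f ⁻¹' S).ncard := by
  rw [← image_inter_preimage, (hf.mono (inter_subset_left.trans hI)).ncard_image]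

lemma IsLatticePathMatroid.exists_pathRep {M : Matroid α} (h : IsLatticePathMatroid M) :
    ∃ f n p q, PathRep M f n p q := by
  obtain ⟨m, r, P, Q, hP, hQ, hPQ, f, hf, hM⟩ := h
  have hE : f '' M.E = Icc 1 (m + r) := by
    have := congrArg Matroid.E hM
    rwa [map_ground] at this
  refine ⟨f, m + r, fun k => height P k, fun k => height Q k, ?_⟩
  refine ⟨⟨fun x hx => hE ▸ mem_image_of_mem f hx, hf, hE.ge⟩, by simp [height_zero],
    by simp [height_zero], ?_, ?_, ?_, ?_, ?_⟩
  · rw [hP.height_of_le le_rfl, hQ.height_of_le le_rfl]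
  · intro k _
    have := height_succ_le P k
    have := height_mono P (Nat.le_succ k)
    simp only [Nat.succ_eq_add_one] at *
    omega
  · intro k _
    have := height_succ_le Q k
    have := height_mono Q (Nat.le_succ k)
    simp only [Nat.succ_eq_add_one] at *
    omega
  · intro k _
    exact_mod_cast hPQ k
  · intro I hI
    rw [← map_image_indep_iff (hf := hf) hI, hM,
      pathMatroid_indep_iff hP hQ hPQ (hE ▸ image_mono hI)]
    refine forall₄_congr fun a b _ _ => ?_
    rw [ncard_image_inter_eq hf hI]
    omega

namespace PathRep

variable {M : Matroid α} {f : α → ℕ} {n : ℕ} {p q : ℕ → ℤ}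

lemma p_mono (H : PathRep M f n p q) {s t : ℕ} (hst : s ≤ t) (ht : t ≤ n) : p s ≤ p t := by
  induction t, hst using Nat.le_induction with
  | base => exact le_rfl
  | succ t _ ih => exact (ih (by omega)).trans (H.p_step t (by omega)).1

lemma q_mono (H : PathRep M f n p q) {s t : ℕ} (hst : s ≤ t) (ht : t ≤ n) : q s ≤ q t := by
  induction t, hst using Nat.le_induction with
  | base => exact le_rfl
  | succ t _ ih => exact (ih (by omega)).trans (H.q_step t (by omega)).1

lemma p_le_add (H : PathRep M f n p q) {s t : ℕ} (hst : s ≤ t) (ht : t ≤ n) :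
    p t ≤ p s + (t - s : ℤ) := by
  induction t, hst using Nat.le_induction with
  | base => simp
  | succ t _ ih =>
    have := ih (by omega)
    have := (H.p_step t (by omega)).2
    push_cast
    omega

lemma q_le_add (H : PathRep M f n p q) {s t : ℕ} (hst : s ≤ t) (ht : t ≤ n) :
    q t ≤ q s + (t - s : ℤ) := by
  induction t, hst using Nat.le_induction with
  | base => simp
  | succ t _ ih =>
    have := ih (by omega)
    have := (H.q_step t (by omega)).2
    push_cast
    omega

lemma isLatticePathMatroid (H : PathRep M f n p q) : IsLatticePathMatroid M := by
  have hp : ∀ k ≤ n, ((p k).toNat : ℤ) = p k := fun k hk =>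
    Int.toNat_of_nonneg (H.p_zero ▸ H.p_mono (Nat.zero_le k) hk)
  have hq : ∀ k ≤ n, ((q k).toNat : ℤ) = q k := fun k hk =>
    Int.toNat_of_nonneg (H.q_zero ▸ H.q_mono (Nat.zero_le k) hk)
  have hrn : q n ≤ n := by
    have := H.q_le_add (Nat.zero_le n) le_rfl
    rw [H.q_zero] at this
    simpa using this
  obtain ⟨m, hm⟩ : ∃ m, n = m + (q n).toNat :=
    ⟨n - (q n).toNat, by have := hq n le_rfl; omega⟩
  have hp0 : (p 0).toNat = 0 := by rw [H.p_zero]; rfl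
  have hq0 : (q 0).toNat = 0 := by rw [H.q_zero]; rfl
  have hps : ∀ k < m + (q n).toNat, (p k).toNat ≤ (p (k + 1)).toNat ∧
      (p (k + 1)).toNat ≤ (p k).toNat + 1 := fun k hk => by
    have := H.p_step k (by omega)
    omega
  have hqs : ∀ k < m + (q n).toNat, (q k).toNat ≤ (q (k + 1)).toNat ∧
      (q (k + 1)).toNat ≤ (q k).toNat + 1 := fun k hk => by
    have := H.q_step k (by omega)
    omega
  have hP := isPathTo_pathOf (g := fun k => (p k).toNat) hp0
    (by simp only [← hm, H.last]) hps
  have hQ := isPathTo_pathOf (g := fun k => (q k).toNat) hq0 (by simp only [← hm]) hqs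
  have hhP := fun k (hk : k ≤ m + (q n).toNat) =>
    height_pathOf (g := fun k => (p k).toNat) hp0 hps hk
  have hhQ := fun k (hk : k ≤ m + (q n).toNat) =>
    height_pathOf (g := fun k => (q k).toNat) hq0 hqs hk
  have hPQ : NeverAbove (pathOf (fun k => (p k).toNat) (m + (q n).toNat))
      (pathOf (fun k => (q k).toNat) (m + (q n).toNat)) := by
    intro k
    rcases le_total k (m + (q n).toNat) with hk | hk
    · rw [hhP k hk, hhQ k hk]
      exact Int.toNat_le_toNat (H.le k (by omega))
    · rw [hP.height_of_le hk, hQ.height_of_le hk]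
  refine ⟨m, (q n).toNat, _, _, hP, hQ, hPQ, f, H.bij.injOn, ?_⟩
  have hE : f '' M.E = Icc 1 (m + (q n).toNat) := by rw [← hm]; exact H.bij.image_eq
  refine ext_indep hE fun I hI => ?_
  rw [map_ground] at hI
  obtain ⟨J, hJ, rfl⟩ := subset_image_iff.1 hI
  rw [map_image_indep_iff hJ, pathMatroid_indep_iff hP hQ hPQ (hI.trans hE.le), H.indep_iff J hJ]
  refine forall_congr' fun a => forall_congr' fun b => forall_congr' fun hab => ?_
  rw [← hm]
  refine forall_congr' fun hb => ?_
  have h1 := hhP a (by omega)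
  have h2 := hhQ b (by omega)
  rw [← hm] at h1 h2
  rw [h1, h2, ncard_image_inter_eq H.bij.injOn hJ]
  have := hp a (by omega)
  have := hq b (by omega)
  omega

end PathRep

/-! ### Integer-valued rank in a finite matroid. -/

section Rank

variable {M : Matroid α} {X Y I : Set α}

lemma rk_eq_of_isBasis (h : M.IsBasis I X) : rk M X = I.ncard := by
  rw [rk, h.eRk_eq_encard, ncard_def]

lemma rk_eq_of_indep (h : M.Indep I) : rk M I = I.ncard :=
  rk_eq_of_isBasis h.isBasis_self

variable [M.Finite]

lemma cast_rk (M : Matroid α) [M.Finite] (X : Set α) : ((M.eRk X).toNat : ℕ∞) = M.eRk X :=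
  ENat.natCast_toNat (eRk_ne_top_iff.2 (M.isRkFinite_set X))

lemma rk_mono (h : X ⊆ Y) : rk M X ≤ rk M Y := by
  have h1 := M.eRk_mono h
  rw [← cast_rk M X, ← cast_rk M Y] at h1
  unfold rk
  exact_mod_cast h1

lemma rk_inter_add_rk_union_le (M : Matroid α) [M.Finite] (X Y : Set α) :
    rk M (X ∩ Y) + rk M (X ∪ Y) ≤ rk M X + rk M Y := by
  have h1 := M.eRk_inter_add_eRk_union_le X Y
  rw [← cast_rk M X, ← cast_rk M Y, ← cast_rk M (X ∩ Y), ← cast_rk M (X ∪ Y)] at h1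
  unfold rk
  exact_mod_cast h1

lemma ncard_le_rk (hI : M.Indep I) (hIX : I ⊆ X) : (I.ncard : ℤ) ≤ rk M X :=
  rk_eq_of_indep hI ▸ rk_mono hIX

lemma finite_of_subset_ground (hX : X ⊆ M.E) : X.Finite := M.ground_finite.subset hX

lemma isBasis_of_indep_of_ncard_ge (hI : M.Indep I) (hIX : I ⊆ X) (hX : X ⊆ M.E)
    (h : ∀ J ⊆ X, M.Indep J → J.ncard ≤ I.ncard) : M.IsBasis I X := by
  obtain ⟨J, hJ, hIJ⟩ := hI.subset_isBasis_of_subset hIX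
  have := eq_of_subset_of_ncard_le hIJ (h J hJ.subset hJ.indep)
    (finite_of_subset_ground hJ.indep.subset_ground)
  exact this ▸ hJ

end Rank

/-! ### Circuits, independent sets and ranks of windows. -/

namespace PathRep

/-- The elements of `M` that `f` maps to `{a + 1, …, b}`. -/
def seg (M : Matroid α) (f : α → ℕ) (a b : ℕ) : Set α := M.E ∩ f ⁻¹' Ioc a b

/-- The elements of `M` at which the path with height function `w` takes a North step. -/
def norths (M : Matroid α) (f : α → ℕ) (a b : ℕ) (w : ℕ → ℤ) : Set α :=
  {x ∈ seg M f a b | w (f x - 1) < w (f x)}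

variable {M : Matroid α} {f : α → ℕ} {n : ℕ} {p q : ℕ → ℤ}

lemma mem_seg {a b : ℕ} {x : α} : x ∈ seg M f a b ↔ x ∈ M.E ∧ a < f x ∧ f x ≤ b := Iff.rfl

lemma seg_subset_ground (M : Matroid α) (f : α → ℕ) (a b : ℕ) : seg M f a b ⊆ M.E :=
  inter_subset_left

lemma norths_subset_seg (M : Matroid α) (f : α → ℕ) (a b : ℕ) (w : ℕ → ℤ) :
    norths M f a b w ⊆ seg M f a b := sep_subset _ _

lemma finite_ground (H : PathRep M f n p q) : M.E.Finite :=
  H.bij.finite_iff_finite.2 (finite_Icc 1 n)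

lemma finite (H : PathRep M f n p q) : M.Finite := ⟨H.finite_ground⟩

lemma exists_apply_eq (H : PathRep M f n p q) {k : ℕ} (hk : 1 ≤ k) (hkn : k ≤ n) :
    ∃ x ∈ M.E, f x = k := by
  obtain ⟨x, hx, hxk⟩ := H.bij.surjOn ⟨hk, hkn⟩
  exact ⟨x, hx, hxk⟩

lemma one_le (H : PathRep M f n p q) {x : α} (hx : x ∈ M.E) : 1 ≤ f x := (H.bij.mapsTo hx).1

lemma le_n (H : PathRep M f n p q) {x : α} (hx : x ∈ M.E) : f x ≤ n := (H.bij.mapsTo hx).2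

lemma seg_zero_n (H : PathRep M f n p q) : seg M f 0 n = M.E :=
  subset_antisymm (seg_subset_ground ..) fun _ hx => ⟨hx, H.one_le hx, H.le_n hx⟩

lemma ncard_inter_Ioc_add (f : α → ℕ) {I : Set α} (hI : I.Finite) {s t u : ℕ} (hst : s ≤ t)
    (htu : t ≤ u) : (I ∩ f ⁻¹' Ioc s u).ncard =
      (I ∩ f ⁻¹' Ioc s t).ncard + (I ∩ f ⁻¹' Ioc t u).ncard := by
  rw [← ncard_union_eq _ (hI.subset inter_subset_left) (hI.subset inter_subset_left),
    ← inter_union_distrib_left, ← preimage_union, Ioc_union_Ioc_eq_Ioc hst htu]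
  exact ((Ioc_disjoint_Ioc_of_le le_rfl).preimage f).mono inter_subset_right inter_subset_right

/-- The count telescopes: each position carries one element, which contributes the increment of `w`
there. -/
lemma ncard_norths_inter (H : PathRep M f n p q) {a b : ℕ} (hb : b ≤ n) {w : ℕ → ℤ}
    (hw : ∀ k, a ≤ k → k < b → w k ≤ w (k + 1) ∧ w (k + 1) ≤ w k + 1) {s t : ℕ} (has : a ≤ s)
    (hst : s ≤ t) (htb : t ≤ b) :
    ((norths M f a b w ∩ f ⁻¹' Ioc s t).ncard : ℤ) = w t - w s := by
  have hfin := H.finite_ground.subset ((norths_subset_seg M f a b w).trans (seg_subset_ground ..))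
  induction t, hst using Nat.le_induction with
  | base => simp
  | succ t hst ih =>
    have hstep := hw t (by omega) (by omega)
    rw [ncard_inter_Ioc_add f hfin hst (Nat.le_succ t), Nat.cast_add, ih (by omega)]
    obtain ⟨x, hx, hxt⟩ := H.exists_apply_eq (k := t + 1) (by omega) (by omega)
    have hone : ∀ y ∈ norths M f a b w ∩ f ⁻¹' Ioc t (t + 1), y = x := by
      rintro y ⟨⟨hy, -⟩, hy1, hy2⟩
      exact H.bij.injOn hy.1 hx (by omega)
    by_cases hlt : w t < w (t + 1)
    · have : norths M f a b w ∩ f ⁻¹' Ioc t (t + 1) = {x} := by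
        refine subset_antisymm hone ?_
        rintro y rfl
        exact ⟨⟨⟨hx, by omega, by omega⟩, by rw [hxt]; exact hlt⟩, by simp; omega⟩
      rw [Nat.succ_eq_add_one, this, ncard_singleton]
      push_cast
      omega
    · have : norths M f a b w ∩ f ⁻¹' Ioc t (t + 1) = ∅ := by
        refine eq_empty_of_forall_notMem fun y hy => ?_
        have := hone y hy
        subst this
        have := hy.1.2
        rw [hxt] at this
        exact hlt this
      rw [Nat.succ_eq_add_one, this, ncard_empty]
      push_cast
      omega

lemma inter_eq_self_of_subset_seg {a b s t : ℕ} {I : Set α} (hI : I ⊆ seg M f a b) (hs : s ≤ a)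
    (ht : b ≤ t) : I ∩ f ⁻¹' Ioc s t = I :=
  inter_eq_left.2 fun x hx => by
    have := hI hx
    simp only [mem_seg, mem_preimage, mem_Ioc] at *
    omega

lemma ncard_norths (H : PathRep M f n p q) {a b : ℕ} (hab : a ≤ b) (hb : b ≤ n) {w : ℕ → ℤ}
    (hw : ∀ k, a ≤ k → k < b → w k ≤ w (k + 1) ∧ w (k + 1) ≤ w k + 1) :
    ((norths M f a b w).ncard : ℤ) = w b - w a := by
  rw [← H.ncard_norths_inter hb hw le_rfl hab le_rfl,
    inter_eq_self_of_subset_seg (norths_subset_seg ..) le_rfl le_rfl]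

lemma ncard_seg (H : PathRep M f n p q) {a b : ℕ} (hab : a ≤ b) (hb : b ≤ n) :
    ((seg M f a b).ncard : ℤ) = b - a := by
  -- For the identity as height function every step is North.
  have := H.ncard_norths (w := fun k => k) hab hb (fun k _ _ => by push_cast; omega)
  rw [← this]
  congr 2
  refine (sep_eq_self_iff_mem_true.2 fun x hx => ?_).symm
  have h : a < f x := hx.2.1
  change ((f x - 1 : ℕ) : ℤ) < f x
  omega

/-- Hall's condition for the interval `{a + 1, …, b}` bounds the sizes of independent sets. -/
lemma ncard_le (H : PathRep M f n p q) {a b : ℕ} (hab : a < b) (hb : b ≤ n) {I : Set α}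
    (hI : M.Indep I) (hIs : I ⊆ seg M f a b) : (I.ncard : ℤ) ≤ q b - p a := by
  have := (H.indep_iff I hI.subset_ground).1 hI a b hab hb
  rwa [inter_eq_self_of_subset_seg hIs le_rfl le_rfl] at this

lemma ncard_diff_singleton_cast {C : Set α} (hC : C.Finite) {x : α} (hx : x ∈ C) :
    ((C \ {x}).ncard : ℤ) = C.ncard - 1 := by
  have := ncard_sdiff_singleton_add_one hx hC
  omega

/-- Some window is overfull. The part of `C` in it is already dependent, so it is all of `C`;
deleting one element restores independence, so the excess is exactly one. -/
lemma exists_of_isCircuit (H : PathRep M f n p q) {C : Set α} (hC : M.IsCircuit C) :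
    ∃ a b, a < b ∧ b ≤ n ∧ C ⊆ seg M f a b ∧ (C.ncard : ℤ) = q b - p a + 1 := by
  have hfin := H.finite_ground.subset hC.subset_ground
  have h1 := hC.not_indep
  rw [H.indep_iff C hC.subset_ground] at h1
  push Not at h1
  obtain ⟨a, b, hab, hb, hlt⟩ := h1
  have hCs : C ⊆ seg M f a b := by
    have : C ∩ f ⁻¹' Ioc a b = C := by
      refine hC.eq_of_not_indep_subset (fun hI => ?_) inter_subset_left
      have := H.ncard_le hab hb hI fun x hx => ⟨hC.subset_ground hx.1, hx.2⟩
      omega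
    exact fun x hx => ⟨hC.subset_ground hx, (inter_eq_left.1 this) hx⟩
  rw [inter_eq_self_of_subset_seg hCs le_rfl le_rfl] at hlt
  obtain ⟨x, hx⟩ := hC.nonempty
  have h2 := H.ncard_le hab hb (hC.sdiff_singleton_indep hx) (sdiff_subset.trans hCs)
  rw [ncard_diff_singleton_cast hfin hx] at h2
  exact ⟨a, b, hab, hb, hCs, by omega⟩

/-- If the paths met at `k`, take a circuit through positions `k` and `k + 1`, filling its window
`{a + 1, …, b}` to `q b - p a + 1`. Its two parts on either side of `k` are independent, so they
have at most `q k - p a` and `q b - p k` elements; with `p k = q k` this is one too few. -/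
lemma p_lt_q (H : PathRep M f n p q) (hM : IsConnected M) {k : ℕ} (hk : 0 < k) (hkn : k < n) :
    p k < q k := by
  refine lt_of_le_of_ne (H.le k hkn.le) fun heq => ?_
  obtain ⟨x, hx, hxk⟩ := H.exists_apply_eq (k := k) hk hkn.le
  obtain ⟨y, hy, hyk⟩ := H.exists_apply_eq (k := k + 1) (by omega) hkn
  obtain ⟨C, hC, hxC, hyC⟩ := hM x hx y hy (by rintro rfl; omega)
  obtain ⟨a, b, hab, hb, hCs, hcard⟩ := H.exists_of_isCircuit hC
  have hfin := H.finite_ground.subset hC.subset_ground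
  have hxs := hCs hxC
  have hys := hCs hyC
  rw [mem_seg] at hxs hys
  have hadd := ncard_inter_Ioc_add f hfin (show a ≤ k by omega) (show k ≤ b by omega)
  rw [inter_eq_self_of_subset_seg hCs le_rfl le_rfl] at hadd
  have h1 : M.Indep (C ∩ f ⁻¹' Ioc a k) := by
    refine hC.ssubset_indep ⟨inter_subset_left, fun h => ?_⟩
    have := (h hyC).2.2
    omega
  have h2 : M.Indep (C ∩ f ⁻¹' Ioc k b) := by
    refine hC.ssubset_indep ⟨inter_subset_left, fun h => ?_⟩
    have := (h hxC).2.1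
    omega
  have h3 := H.ncard_le (by omega) hkn.le h1 fun z hz => ⟨hC.subset_ground hz.1, hz.2⟩
  have h4 := H.ncard_le (by omega) hb h2 fun z hz => ⟨hC.subset_ground hz.1, hz.2⟩
  omega

/-- A window is first clipped to `{a + 1, …, b}`; there the count is a difference of two values of
`w`, and in the difference of the two bounds `p a` cancels. -/
lemma indep_norths (H : PathRep M f n p q) {a b : ℕ} (hb : b ≤ n) {w : ℕ → ℤ}
    (hw : ∀ k, a ≤ k → k < b → w k ≤ w (k + 1) ∧ w (k + 1) ≤ w k + 1)
    (hlow : ∀ k, a ≤ k → k ≤ b → p k - p a ≤ w k) (hup : ∀ k, a ≤ k → k ≤ b → w k ≤ q k - p a) :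
    M.Indep (norths M f a b w) := by
  have hsub := (norths_subset_seg M f a b w).trans (seg_subset_ground ..)
  have hfin := H.finite_ground.subset hsub
  refine (H.indep_iff _ hsub).2 fun s t hst htn => ?_
  have heq : norths M f a b w ∩ f ⁻¹' Ioc s t =
      norths M f a b w ∩ f ⁻¹' Ioc (max s a) (min t b) := by
    ext x
    refine and_congr_right fun hx => ?_
    have h1 := hx.1.2
    simp only [mem_preimage, mem_Ioc] at h1 ⊢
    omega
  rw [heq]
  rcases le_or_gt (max s a) (min t b) with h | h
  · rw [H.ncard_norths_inter hb hw (le_max_right _ _) h (min_le_right _ _)]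
    have h1 := hup (min t b) (by omega) (min_le_right _ _)
    have h2 := hlow (max s a) (le_max_right _ _) (by omega)
    have h3 := H.q_mono (min_le_left t b) htn
    have h4 := H.p_mono (le_max_left s a) (by omega)
    omega
  · rw [Ioc_eq_empty (by omega), preimage_empty, inter_empty, ncard_empty]
    have h1 := H.p_mono hst.le htn
    have h2 := H.le t htn
    push_cast
    omega

/-- The upper bounding path of the restriction to `{a + 1, …, b}`. -/
def upper (p q : ℕ → ℤ) (a k : ℕ) : ℤ := min (q k - p a) (k - a)

/-- The lower bounding path of the restriction to `{a + 1, …, b}`. -/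
def lower (p q : ℕ → ℤ) (a b k : ℕ) : ℤ := max (p k - p a) (q b - p a - (b - k))

lemma upper_step (H : PathRep M f n p q) (a : ℕ) {k : ℕ} (hk : k < n) :
    upper p q a k ≤ upper p q a (k + 1) ∧ upper p q a (k + 1) ≤ upper p q a k + 1 := by
  have := H.q_step k hk
  simp only [upper]
  push_cast
  omega

lemma lower_step (H : PathRep M f n p q) (a b : ℕ) {k : ℕ} (hk : k < n) :
    lower p q a b k ≤ lower p q a b (k + 1) ∧ lower p q a b (k + 1) ≤ lower p q a b k + 1 := by
  have := H.p_step k hk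
  simp only [lower]
  push_cast
  omega

lemma upper_mono (H : PathRep M f n p q) (a : ℕ) {s t : ℕ} (hst : s ≤ t) (ht : t ≤ n) :
    upper p q a s ≤ upper p q a t := by
  have := H.q_mono hst ht
  simp only [upper]
  omega

lemma lower_mono (H : PathRep M f n p q) (a b : ℕ) {s t : ℕ} (hst : s ≤ t) (ht : t ≤ n) :
    lower p q a b s ≤ lower p q a b t := by
  have := H.p_mono hst ht
  simp only [lower]
  omega

lemma indep_norths_of_mem (H : PathRep M f n p q) {a b : ℕ} (hb : b ≤ n) {w : ℕ → ℤ}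
    (hw : ∀ k, a ≤ k → k < b → w k ≤ w (k + 1) ∧ w (k + 1) ≤ w k + 1)
    (hlow : ∀ k, a ≤ k → k ≤ b → lower p q a b k ≤ w k)
    (hup : ∀ k, a ≤ k → k ≤ b → w k ≤ upper p q a k) : M.Indep (norths M f a b w) :=
  H.indep_norths hb hw (fun k h1 h2 => (le_max_left _ _).trans (hlow k h1 h2))
    fun k h1 h2 => (hup k h1 h2).trans (min_le_left _ _)

/-- The North steps of the upper path attain the window bound. The assumption `hR` excludes windows
too short to contain that many elements. -/
lemma exists_isBasis_seg (H : PathRep M f n p q) {a b : ℕ} (hab : a < b) (hb : b ≤ n)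
    (hR : q b - p a ≤ b - a) :
    ∃ I, M.IsBasis I (seg M f a b) ∧ (I.ncard : ℤ) = q b - p a := by
  have := H.finite
  have hw : ∀ k, a ≤ k → k < b → upper p q a k ≤ upper p q a (k + 1) ∧
    upper p q a (k + 1) ≤ upper p q a k + 1 := fun k _ hk => H.upper_step a (by omega)
  have hcard := H.ncard_norths hab.le hb hw
  have hin : M.Indep (norths M f a b (upper p q a)) := by
    refine H.indep_norths hb hw (fun k hak hkb => ?_) fun k hak hkb => ?_
    · have h1 := H.p_le_add hak (hkb.trans hb)
      have h2 := H.le k (hkb.trans hb)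
      simp only [upper]
      omega
    · exact min_le_left _ _
  have hcard' : ((norths M f a b (upper p q a)).ncard : ℤ) = q b - p a := by
    rw [hcard]
    have := H.le a (by omega)
    simp only [upper]
    omega
  refine ⟨_, isBasis_of_indep_of_ncard_ge hin (norths_subset_seg ..) (seg_subset_ground ..)
    fun J hJs hJ => ?_, hcard'⟩
  have := H.ncard_le hab hb hJ hJs
  omega

lemma rk_seg (H : PathRep M f n p q) {a b : ℕ} (hab : a < b) (hb : b ≤ n)
    (hR : q b - p a ≤ b - a) : rk M (seg M f a b) = q b - p a := by
  obtain ⟨I, hI, hcard⟩ := H.exists_isBasis_seg hab hb hR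
  rw [rk_eq_of_isBasis hI, hcard]

lemma rk_ground (H : PathRep M f n p q) : rk M M.E = q n := by
  rcases Nat.eq_zero_or_pos n with rfl | hn
  · have hE : M.E = ∅ := by
      rw [← H.seg_zero_n, seg, Ioc_self, preimage_empty, inter_empty]
    have h := rk_eq_of_indep M.empty_indep
    rw [hE, h, H.q_zero, ncard_empty]
    rfl
  · have h1 := H.q_le_add (Nat.zero_le n) le_rfl
    rw [H.q_zero] at h1
    have h := H.rk_seg hn le_rfl (by rw [H.p_zero]; omega)
    rwa [H.seg_zero_n, H.p_zero, sub_zero] at h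

/-! ### Connected flats are the windows between corners. -/

/-- The interval `{a + 1, …, b}` is bounded by corners of the two bounding paths and is
dependent. -/
structure Corners (n : ℕ) (p q : ℕ → ℤ) (a b : ℕ) : Prop where
  lt : a < b
  le : b ≤ n
  p_east : p (a + 1) = p a
  q_east : q (b - 1) = q b
  p_north : a = 0 ∨ p (a - 1) < p a
  q_north : b = n ∨ q b < q (b + 1)
  dep : q b - p a < b - a

/-- A minimum against a maximum gives four comparisons: connectedness settles `p` against `q`, the
East steps `p_east` and `q_east` settle each path against a diagonal, and `dep` settles the two
diagonals. -/
lemma Corners.lower_lt_upper {a b : ℕ} (h : Corners n p q a b) (H : PathRep M f n p q)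
    (hM : IsConnected M) {k : ℕ} (hak : a < k) (hkb : k < b) :
    lower p q a b k < upper p q a k := by
  have hb := h.le
  have h1 := H.p_lt_q hM (k := k) (by omega) (by omega)
  have h2 := H.p_le_add (s := a + 1) (t := k) (by omega) (by omega)
  have h3 := H.q_le_add (s := k) (t := b - 1) (by omega) (by omega)
  have h4 := h.p_east
  have h5 := h.q_east
  have h6 := h.dep
  push_cast at h2
  rw [Nat.cast_sub (by omega)] at h3
  simp only [lower, upper]
  omega

/-- The circuit is the fundamental circuit of `g` over the North steps of a path that uses `e` and
avoids `g`. It contains `e` because exchanging `e` for `g` again gives the North steps of an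
admissible path. -/
lemma Corners.exists_isCircuit {a b : ℕ} (h : Corners n p q a b) (H : PathRep M f n p q)
    (hM : IsConnected M) {e g : α} (he : e ∈ seg M f a b) (hg : g ∈ seg M f a b)
    (heg : f e < f g) : ∃ C ⊆ seg M f a b, M.IsCircuit C ∧ e ∈ C ∧ g ∈ C := by
  have hb := h.le
  obtain ⟨heE, hae, heb⟩ := he
  obtain ⟨hgE, hag, hgb⟩ := hg
  have hLU := fun k (h1 : a < k) (h2 : k < b) => h.lower_lt_upper H hM h1 h2
  have hLU' : ∀ k, a ≤ k → k ≤ b → lower p q a b k ≤ upper p q a k := by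
    intro k h1 h2
    rcases eq_or_lt_of_le h1 with rfl | h1
    · have := H.le a (by omega)
      have := h.dep
      simp only [lower, upper]
      omega
    rcases eq_or_lt_of_le h2 with rfl | h2
    · have := H.le k hb
      have := h.dep
      have := H.p_le_add h1.le hb
      simp only [lower, upper]
      omega
    exact (hLU k h1 h2).le
  set L := lower p q a b
  set U := upper p q a
  obtain ⟨s, hs⟩ : ∃ s, f e = s + 1 := ⟨f e - 1, by have := H.one_le heE; omega⟩
  obtain ⟨t, ht⟩ : ∃ t, f g = t + 1 := ⟨f g - 1, by omega⟩
  -- A path with a North step at `e` and an East step at `g` that stays strictly above the lower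
  -- bounding path in between.
  let w : ℕ → ℤ := fun k => if k ≤ s then min (U k) (U (s + 1) - 1)
    else if k ≤ t then U k else max (L k) (U t)
  -- Lowering the path by one between the two positions makes the step at `e` East and the step at
  -- `g` North, and changes no other step.
  let w' : ℕ → ℤ := fun k => if s < k ∧ k ≤ t then w k - 1 else w k
  have hUs : ∀ k < n, U k ≤ U (k + 1) ∧ U (k + 1) ≤ U k + 1 := fun k hk => H.upper_step a hk
  have hLs : ∀ k < n, L k ≤ L (k + 1) ∧ L (k + 1) ≤ L k + 1 := fun k hk => H.lower_step a b hk
  have hst : s < t := by omega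
  have hws : w s = U (s + 1) - 1 := by
    have := hUs s (by omega)
    simp only [w, le_refl, if_true]
    omega
  have hws' : w (s + 1) = U (s + 1) := by
    simp only [w]
    rw [if_neg (by omega), if_pos (by omega)]
  have hwt : w t = U t := by
    simp only [w]
    rw [if_neg (by omega), if_pos le_rfl]
  have hwt' : w (t + 1) = U t := by
    have h1 := hLs t (by omega)
    have h2 := hLU t (by omega) (by omega)
    simp only [w]
    rw [if_neg (by omega), if_neg (by omega)]
    omega
  have hstep : ∀ k, a ≤ k → k < b → w k ≤ w (k + 1) ∧ w (k + 1) ≤ w k + 1 := by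
    intro k hak hkb
    have h1 := hUs k (by omega)
    have h2 := hLs k (by omega)
    rcases lt_trichotomy k s with hk | rfl | hk
    · simp only [w]
      rw [if_pos (by omega), if_pos (by omega)]
      omega
    · omega
    rcases lt_trichotomy k t with hk' | rfl | hk'
    · simp only [w]
      rw [if_neg (by omega), if_pos (by omega), if_neg (by omega), if_pos (by omega)]
      omega
    · omega
    · simp only [w]
      rw [if_neg (by omega), if_neg (by omega), if_neg (by omega), if_neg (by omega)]
      omega
  have hlow : ∀ k, a ≤ k → k ≤ b → L k ≤ w k := by
    intro k hak hkb
    have h1 := hLU' k hak hkb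
    simp only [w]
    split_ifs with hk hk'
    · have h2 := H.lower_mono a b (show k ≤ s + 1 by omega) (by omega)
      have h3 := hLU (s + 1) (by omega) (by omega)
      simp only [L, U] at *
      omega
    · exact h1
    · exact le_max_left _ _
  have hup : ∀ k, a ≤ k → k ≤ b → w k ≤ U k := by
    intro k hak hkb
    have h1 := hLU' k hak hkb
    simp only [w]
    split_ifs with hk hk'
    · exact min_le_left _ _
    · exact le_rfl
    · exact max_le h1 (H.upper_mono a (by omega) (by omega))
  have hstep' : ∀ k, a ≤ k → k < b → w' k ≤ w' (k + 1) ∧ w' (k + 1) ≤ w' k + 1 := by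
    intro k hak hkb
    have h1 := hstep k hak hkb
    simp only [w']
    rcases lt_trichotomy k s with hk | rfl | hk
    · rw [if_neg (by omega), if_neg (by omega)]; omega
    · rw [if_neg (by omega), if_pos (by omega)]; omega
    rcases lt_trichotomy k t with hk' | rfl | hk'
    · rw [if_pos (by omega), if_pos (by omega)]; omega
    · rw [if_pos (by omega), if_neg (by omega)]; omega
    · rw [if_neg (by omega), if_neg (by omega)]; omega
  have hlow' : ∀ k, a ≤ k → k ≤ b → L k ≤ w' k := by
    intro k hak hkb
    have h1 := hlow k hak hkb
    simp only [w']
    split_ifs with hk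
    · have h2 := hLU k (by omega) (by omega)
      simp only [w]
      rw [if_neg (by omega), if_pos (by omega)]
      omega
    · exact h1
  have hup' : ∀ k, a ≤ k → k ≤ b → w' k ≤ U k := by
    intro k hak hkb
    have h1 := hup k hak hkb
    simp only [w']
    split_ifs <;> omega
  have hI := H.indep_norths_of_mem hb hstep hlow hup
  have hI' := H.indep_norths_of_mem hb hstep' hlow' hup'
  have heI : e ∈ norths M f a b w := by
    refine ⟨⟨heE, hae, heb⟩, ?_⟩
    rw [hs, Nat.add_sub_cancel]
    omega
  have hgI : g ∉ norths M f a b w := by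
    rintro ⟨-, hlt⟩
    rw [ht, Nat.add_sub_cancel] at hlt
    omega
  have hsub : insert g (norths M f a b w) \ {e} ⊆ norths M f a b w' := by
    rintro x ⟨rfl | hx, hxe⟩
    · refine ⟨⟨hgE, hag, hgb⟩, ?_⟩
      rw [ht, Nat.add_sub_cancel]
      simp only [w']
      rw [if_pos (by omega), if_neg (by omega)]
      omega
    · obtain ⟨hxs, hlt⟩ := hx
      refine ⟨hxs, ?_⟩
      have h1 : f x ≠ s + 1 := fun h => hxe (H.bij.injOn hxs.1 heE (h.trans hs.symm))
      have h2 : f x ≠ t + 1 := by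
        intro h
        rw [h, Nat.add_sub_cancel] at hlt
        omega
      have h3 := hxs.2.1
      simp only [w']
      split_ifs <;> omega
  have hwb : w b = q b - p a := by
    have h1 := hlow b (by omega) le_rfl
    have h2 := hup b (by omega) le_rfl
    have h3 := h.dep
    simp only [L, U, lower, upper] at h1 h2
    omega
  have hwa : w a = 0 := by
    have h1 := hlow a le_rfl (by omega)
    have h2 := hup a le_rfl (by omega)
    simp only [L, U, lower, upper] at h1 h2
    omega
  have hcard := H.ncard_norths (by omega) hb hstep
  have hsubseg : insert g (norths M f a b w) ⊆ seg M f a b :=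
    insert_subset ⟨hgE, hag, hgb⟩ (norths_subset_seg ..)
  have hfin := H.finite_ground.subset hI.subset_ground
  have hcl : g ∈ M.closure (norths M f a b w) := by
    rw [hI.mem_closure_iff_of_notMem hgI, dep_iff]
    refine ⟨fun hind => ?_, hsubseg.trans (seg_subset_ground ..)⟩
    have h1 := H.ncard_le (by omega) hb hind hsubseg
    rw [ncard_insert_of_notMem hgI hfin] at h1
    push_cast at h1
    omega
  refine ⟨M.fundCircuit g (norths M f a b w), (M.fundCircuit_subset_insert g _).trans hsubseg,
    hI.fundCircuit_isCircuit hcl hgI, ?_, M.mem_fundCircuit g _⟩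
  exact (hI.mem_fundCircuit_iff hcl hgI).2 (hI'.subset hsub)

/-- For flatness, an outside element `y` must keep a basis of the window independent. A test window
containing `y` and reaching into the segment passes a corner's North step, which supplies the extra
unit for `y`; one missing the segment needs only a bound of at least one, given by `p_lt_q`. -/
lemma Corners.isConnectedFlat {a b : ℕ} (h : Corners n p q a b) (H : PathRep M f n p q)
    (hM : IsConnected M) : IsConnectedFlat M (seg M f a b) := by
  have hb := h.le
  have hab := h.lt
  constructor
  · obtain ⟨I, hI, hcard⟩ := H.exists_isBasis_seg hab hb h.dep.le
    rw [isFlat_iff_closure_eq]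
    refine subset_antisymm (fun y hy => ?_) (M.subset_closure _ (seg_subset_ground ..))
    by_contra hys
    have hyE := M.closure_subset_ground _ hy
    have hyI : y ∉ I := fun hyI => hys (hI.subset hyI)
    have hfin := H.finite_ground.subset hI.indep.subset_ground
    rw [← hI.closure_eq_closure, hI.indep.mem_closure_iff_of_notMem hyI] at hy
    refine hy.not_indep ((H.indep_iff _ (insert_subset hyE hI.indep.subset_ground)).2 ?_)
    intro s t hst htn
    by_cases hy1 : f y ∈ Ioc s t
    · rw [insert_inter_of_mem (show y ∈ f ⁻¹' Ioc s t from hy1),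
        ncard_insert_of_notMem (fun h => hyI h.1) (hfin.subset inter_subset_left)]
      push_cast
      have hIst := (H.indep_iff _ hI.indep.subset_ground).1 hI.indep
      have hy2 : f y ≤ a ∨ b < f y := by
        by_contra! hc
        exact hys ⟨hyE, hc⟩
      have hyn := H.le_n hyE
      have hIs := hI.subset
      rcases hy2 with hy2 | hy2
      · have hpa := h.p_north.resolve_left (by have := H.one_le hyE; omega)
        have hps := H.p_mono (show s ≤ a - 1 by have := hy1.1; omega) (by omega)
        rcases le_or_gt t a with hta | hta
        · have : I ∩ f ⁻¹' Ioc s t = ∅ := by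
            refine eq_empty_of_forall_notMem fun x hx => ?_
            have h1 := (hIs hx.1).2.1
            have h2 := hx.2.2
            omega
          rw [this, ncard_empty]
          have h1 := H.p_lt_q hM (k := t) (by have := H.one_le hyE; have := hy1.2; omega)
            (by omega)
          have h2 := H.p_mono hst.le htn
          push_cast
          omega
        · have : I ∩ f ⁻¹' Ioc s t = I ∩ f ⁻¹' Ioc a t := by
            ext x
            refine and_congr_right fun hx => ?_
            have h1 := (hIs hx).2
            simp only [mem_preimage, mem_Ioc] at h1 hy1 ⊢
            omega
          rw [this]
          have := hIst a t hta htn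
          omega
      · have hqb := h.q_north.resolve_left (by omega)
        have hqt := H.q_mono (show b + 1 ≤ t by have := hy1.2; omega) htn
        rcases le_or_gt b s with hsb | hsb
        · have : I ∩ f ⁻¹' Ioc s t = ∅ := by
            refine eq_empty_of_forall_notMem fun x hx => ?_
            have h1 := (hIs hx.1).2.2
            have h2 := hx.2.1
            omega
          rw [this, ncard_empty]
          have h1 := H.p_lt_q hM (k := s) (by omega) (by omega)
          have h2 := H.q_mono hst.le htn
          push_cast
          omega
        · have : I ∩ f ⁻¹' Ioc s t = I ∩ f ⁻¹' Ioc s b := by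
            ext x
            refine and_congr_right fun hx => ?_
            have h1 := (hIs hx).2
            simp only [mem_preimage, mem_Ioc] at h1 hy1 ⊢
            omega
          rw [this]
          have := hIst s b hsb hb
          omega
    · rw [insert_inter_of_notMem (show y ∉ f ⁻¹' Ioc s t from hy1)]
      exact (H.indep_iff _ hI.indep.subset_ground).1 hI.indep s t hst htn
  · intro x hx y hy hxy
    rw [restrict_ground_eq] at hx hy
    have hne : f x ≠ f y := fun h => hxy (H.bij.injOn hx.1 hy.1 h)
    rcases lt_or_gt_of_ne hne with hlt | hlt
    · obtain ⟨C, hCs, hC, hxC, hyC⟩ := h.exists_isCircuit H hM hx hy hlt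
      exact ⟨C, (restrict_isCircuit_iff (seg_subset_ground ..)).2 ⟨hC, hCs⟩, hxC, hyC⟩
    · obtain ⟨C, hCs, hC, hyC, hxC⟩ := h.exists_isCircuit H hM hy hx hlt
      exact ⟨C, (restrict_isCircuit_iff (seg_subset_ground ..)).2 ⟨hC, hCs⟩, hxC, hyC⟩

/-- A circuit through the first and last elements of `X` spans its window, so `X` is that window. A
North step of `p` just inside the left end would make the circuit minus `x` overfill the shortened
window; an East step just outside would allow a longer window inside the closure, hence inside `X`.
The right end is symmetric. -/
lemma exists_corners (H : PathRep M f n p q) {X : Set α} (hX : IsConnectedFlat M X)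
    (h2 : 1 < X.ncard) : ∃ a b, Corners n p q a b ∧ X = seg M f a b := by
  have := H.finite
  have hXE := hX.1.subset_ground
  have hfin := H.finite_ground.subset hXE
  have hne : X.Nonempty := by
    rw [nonempty_iff_ne_empty]
    rintro rfl
    simp at h2
  obtain ⟨x, hx, hmin⟩ := exists_min_image X f hfin hne
  obtain ⟨y, hy, hmax⟩ := exists_max_image X f hfin hne
  have hxy : x ≠ y := by
    rintro rfl
    have h1 : X ⊆ {x} := fun z hz =>
      H.bij.injOn (hXE hz) (hXE hx) ((hmax z hz).antisymm (hmin z hz))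
    have := ncard_le_ncard h1
    rw [ncard_singleton] at this
    omega
  obtain ⟨C, hCX, hxC, hyC⟩ := hX.2 x hx y hy hxy
  rw [restrict_isCircuit_iff hXE] at hCX
  obtain ⟨hC, hCX⟩ := hCX
  obtain ⟨a, b, hab, hb, hCs, hcard⟩ := H.exists_of_isCircuit hC
  have hCfin := hfin.subset hCX
  have hI := hC.sdiff_singleton_indep hxC
  have hIcard := ncard_diff_singleton_cast hCfin hxC
  -- a larger interval with the same rank is contained in `X`
  have hsegX : ∀ a' b', a' ≤ a → b ≤ b' → b' ≤ n → q b' - p a' ≤ q b - p a →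
      seg M f a' b' ⊆ X := by
    intro a' b' ha' hb' hbn hle
    have hbas : M.IsBasis (C \ {x}) (seg M f a' b') := by
      refine isBasis_of_indep_of_ncard_ge hI (fun z hz => ?_) (seg_subset_ground ..)
        fun J hJs hJ => ?_
      · have := hCs hz.1
        exact ⟨this.1, by have := this.2.1; omega, by have := this.2.2; omega⟩
      · have := H.ncard_le (by omega) hbn hJ hJs
        omega
    refine hbas.subset_closure.trans ?_
    rw [← hX.1.closure]
    exact M.closure_subset_closure (sdiff_subset.trans hCX)
  have hsX := hsegX a b le_rfl le_rfl hb le_rfl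
  have hxs := hCs hxC
  have hys := hCs hyC
  rw [mem_seg] at hxs hys
  have hfxy : f x < f y := lt_of_le_of_ne (hmin y hy)
    fun h => hxy (H.bij.injOn (hXE hx) (hXE hy) h)
  have hfx : f x = a + 1 := by
    obtain ⟨z, hz, hza⟩ := H.exists_apply_eq (k := a + 1) (by omega) (by omega)
    have := hmin z (hsX ⟨hz, by simp only [mem_preimage, mem_Ioc]; omega⟩)
    omega
  have hfy : f y = b := by
    obtain ⟨z, hz, hzb⟩ := H.exists_apply_eq (k := b) (by omega) (by omega)
    have := hmax z (hsX ⟨hz, by simp only [mem_preimage, mem_Ioc]; omega⟩)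
    omega
  have hXseg : X = seg M f a b := by
    refine subset_antisymm (fun z hz => ⟨hXE hz, ?_, ?_⟩) hsX
    · have := hmin z hz
      omega
    · have := hmax z hz
      omega
  refine ⟨a, b, ⟨hab, hb, ?_, ?_, ?_, ?_, ?_⟩, hXseg⟩
  · have hstep := H.p_step a (by omega)
    have h3 : C \ {x} ⊆ seg M f (a + 1) b := by
      rintro z ⟨hz, hzx⟩
      have h4 := hCs hz
      rw [mem_seg] at h4 ⊢
      have h5 : f z ≠ a + 1 := fun h => hzx (H.bij.injOn h4.1 (hXE hx) (h.trans hfx.symm))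
      exact ⟨h4.1, by omega, by omega⟩
    have := H.ncard_le (by omega) hb hI h3
    omega
  · have hstep := H.q_step (b - 1) (by omega)
    rw [Nat.sub_add_cancel (by omega)] at hstep
    have h3 : C \ {y} ⊆ seg M f a (b - 1) := by
      rintro z ⟨hz, hzy⟩
      have h4 := hCs hz
      rw [mem_seg] at h4 ⊢
      have h5 : f z ≠ b := fun h => hzy (H.bij.injOn h4.1 (hXE hy) (h.trans hfy.symm))
      exact ⟨h4.1, by omega, by omega⟩
    have := H.ncard_le (by omega) (by omega) (hC.sdiff_singleton_indep hyC) h3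
    have := ncard_diff_singleton_cast hCfin hyC
    omega
  · by_contra! hc
    obtain ⟨z, hz, hza⟩ := H.exists_apply_eq (k := a) (by omega) (by omega)
    have := hmin z (hsegX (a - 1) b (by omega) le_rfl hb (by omega)
      ⟨hz, by simp only [mem_preimage, mem_Ioc]; omega⟩)
    omega
  · by_contra! hc
    obtain ⟨hbn, hc⟩ := hc
    obtain ⟨z, hz, hzb⟩ := H.exists_apply_eq (k := b + 1) (by omega) (by omega)
    have := hmax z (hsegX a (b + 1) le_rfl (by omega) (by omega) (by omega)
      ⟨hz, by simp only [mem_preimage, mem_Ioc]; omega⟩)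
    omega
  · have h3 := ncard_le_ncard hCs (H.finite_ground.subset (seg_subset_ground ..))
    have h4 := H.ncard_seg hab.le hb
    omega

end PathRep

/-! ### Fundamental flats, and the chains of a lattice path matroid. -/

namespace PathRep

variable {M : Matroid α} {f : α → ℕ} {n : ℕ} {p q : ℕ → ℤ}

/-- Only the full window is overfull, and by one: a window with one end at 0 or `n` still passes,
thanks to `w ≤ q` or `p + 1 ≤ w` at its other end. -/
lemma isCircuit_norths (H : PathRep M f n p q) (hn : 0 < n) {w : ℕ → ℤ}
    (hw : ∀ k, 0 ≤ k → k < n → w k ≤ w (k + 1) ∧ w (k + 1) ≤ w k + 1) (h0 : w 0 = 0)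
    (hwn : w n = q n + 1) (hlow : ∀ k, 0 < k → k < n → p k + 1 ≤ w k)
    (hup : ∀ k, 0 < k → k < n → w k ≤ q k) :
    M.IsCircuit (norths M f 0 n w) ∧ M.Spanning (norths M f 0 n w) := by
  have := H.finite
  have hsub := (norths_subset_seg M f 0 n w).trans (seg_subset_ground ..)
  have hfin := H.finite_ground.subset hsub
  have hcard := H.ncard_norths hn.le le_rfl hw
  have hqn := H.q_mono hn.le le_rfl
  have hq0 := H.q_zero
  have hp0 := H.p_zero
  have hind : ∀ x ∈ norths M f 0 n w, M.Indep (norths M f 0 n w \ {x}) := by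
    intro x hx
    refine (H.indep_iff _ (sdiff_subset.trans hsub)).2 fun s t hst htn => ?_
    have h1 := H.ncard_norths_inter le_rfl hw (Nat.zero_le s) hst.le htn
    have h2 := ncard_le_ncard
      (inter_subset_inter_left (f ⁻¹' Ioc s t) (sdiff_subset (s := norths M f 0 n w) (t := {x})))
      (hfin.subset inter_subset_left)
    rcases Nat.eq_zero_or_pos s with rfl | hs
    · rcases eq_or_lt_of_le htn with rfl | htn
      · have h3 := ncard_diff_singleton_cast hfin hx
        have h4 := ncard_le_ncard (inter_subset_left (s := norths M f 0 t w \ {x})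
          (t := f ⁻¹' Ioc 0 t)) (hfin.subset sdiff_subset)
        omega
      · have := hup t (by omega) htn
        omega
    · have h3 := hlow s hs (by omega)
      rcases eq_or_lt_of_le htn with rfl | htn
      · omega
      · have := hup t (by omega) htn
        omega
  have hdep : M.Dep (norths M f 0 n w) := by
    refine ⟨fun hI => ?_, hsub⟩
    have := H.ncard_le hn le_rfl hI (norths_subset_seg ..)
    omega
  refine ⟨isCircuit_iff_dep_forall_sdiff_singleton_indep.2 ⟨hdep, hind⟩, ?_⟩
  obtain ⟨x, hx⟩ : (norths M f 0 n w).Nonempty := by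
    rw [← ncard_pos hfin]
    omega
  have h3 := ncard_diff_singleton_cast hfin hx
  have hbas : M.IsBasis (norths M f 0 n w \ {x}) M.E :=
    isBasis_of_indep_of_ncard_ge (hind x hx) (sdiff_subset.trans hsub) Subset.rfl fun J hJ hJi => by
      have := H.ncard_le hn le_rfl hJi (H.seg_zero_n ▸ hJ)
      omega
  exact (isBasis_ground_iff.1 hbas).spanning.superset sdiff_subset hsub

lemma Corners.one_lt_ncard {a b : ℕ} (h : Corners n p q a b) (H : PathRep M f n p q)
    (hM : IsConnected M) (hne : 0 < a ∨ b < n) : 1 < (seg M f a b).ncard := by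
  have hab := h.lt
  have hb := h.le
  have h1 := H.ncard_seg hab.le hb
  have h2 : p a < q b := by
    rcases hne with ha | hbn
    · exact (H.p_lt_q hM ha (by omega)).trans_le (H.q_mono hab.le hb)
    · exact (H.p_mono hab.le hb).trans_lt (H.p_lt_q hM (by omega) hbn)
  have := h.dep
  omega

lemma two_le_ncard_of_dep (hM : IsConnected M) {X : Set α} (hXE : X ⊆ M.E) (hfin : X.Finite)
    (hne : X ≠ M.E) (hX : ¬ M.Indep X) : 1 < X.ncard := by
  by_contra! hc
  obtain ⟨e, he⟩ : X.Nonempty := by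
    rw [nonempty_iff_ne_empty]
    rintro rfl
    exact hX M.empty_indep
  have hXe : X = {e} := by
    refine subset_antisymm (fun y hy => ?_) (singleton_subset_iff.2 he)
    exact ncard_le_one hfin |>.1 hc y hy e he
  subst hXe
  obtain ⟨g, hg, hge⟩ := exists_of_ssubset (hXE.ssubset_of_ne hne)
  obtain ⟨C, hC, heC, hgC⟩ := hM e (hXE he) g hg (by rintro rfl; exact hge he)
  have := hC.eq_of_not_indep_subset hX (singleton_subset_iff.2 heC)
  rw [← this] at hgC
  exact hge hgC

lemma not_indep_of_isConnected {X : Set α} (hXE : X ⊆ M.E) (hX : IsConnected (M.restrict X))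
    (h : 1 < X.ncard) : ¬ M.Indep X := by
  intro hI
  obtain ⟨x, hx, y, hy, hxy⟩ :=
    (one_lt_ncard (finite_of_ncard_pos (by omega))).1 h
  obtain ⟨C, hC, -, -⟩ := hX x hx y hy hxy
  rw [restrict_isCircuit_iff hXE] at hC
  exact hC.1.not_indep (hI.subset hC.2)

lemma Corners.seg_ne_ground {a b : ℕ} (h : Corners n p q a b) (H : PathRep M f n p q)
    (hne : 0 < a ∨ b < n) : seg M f a b ≠ M.E := by
  intro heq
  have h1 := H.ncard_seg h.lt.le h.le
  have h2 := H.ncard_seg (Nat.zero_le n) le_rfl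
  rw [H.seg_zero_n, ← heq, h1] at h2
  have := h.lt
  have := h.le
  omega

lemma isProperNontrivialConnectedFlat_iff (H : PathRep M f n p q) (hM : IsConnected M)
    {X : Set α} : IsProperNontrivialConnectedFlat M X ↔
      ∃ a b, Corners n p q a b ∧ X = seg M f a b ∧ (0 < a ∨ b < n) := by
  constructor
  · rintro ⟨hX, hne, hdep⟩
    have hXE := hX.1.subset_ground
    obtain ⟨a, b, hab, rfl⟩ := H.exists_corners hX
      (two_le_ncard_of_dep hM hXE (H.finite_ground.subset hXE) hne hdep)
    refine ⟨a, b, hab, rfl, ?_⟩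
    by_contra! hc
    have := hab.le
    obtain rfl : a = 0 := by omega
    obtain rfl : b = n := by omega
    exact hne H.seg_zero_n
  · rintro ⟨a, b, hab, rfl, hne⟩
    have hflat := hab.isConnectedFlat H hM
    exact ⟨hflat, hab.seg_ne_ground H hne,
      not_indep_of_isConnected hflat.1.subset_ground hflat.2 (hab.one_lt_ncard H hM hne)⟩

/-- A spanning circuit `C` has `q n + 1` elements, of which `q b - p a` would lie in the window. If
`C` has elements on both sides, its parts in `{1, …, b}` and `{a + 1, …, n}` have at most `q b` and
`q n - p a` elements, and inclusion-exclusion gives at most `q n` in all. If one side is empty, `C`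
minus an element is a basis inside a final or initial window of too small rank. -/
lemma Corners.not_isFundamentalFlat {a b : ℕ} (h : Corners n p q a b) (H : PathRep M f n p q)
    (ha : 0 < a) (hb : b < n) : ¬ IsFundamentalFlat M (seg M f a b) := by
  have := H.finite
  rintro ⟨-, -, -, C, hC, hCs, hCb⟩
  have hab := h.lt
  have hCfin := H.finite_ground.subset hC.subset_ground
  have h1 := rk_eq_of_isBasis hCb
  rw [H.rk_seg hab hb.le h.dep.le] at h1
  have h2 : (C.ncard : ℤ) = q n + 1 := by
    obtain ⟨x, hx⟩ := hC.nonempty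
    have h3 := rk_eq_of_isBasis (hC.sdiff_singleton_isBasis hx)
    rw [ncard_diff_singleton_cast hCfin hx, rk, hCs.eRk_eq, ← eRk_ground, ← rk, H.rk_ground] at h3
    omega
  have hsub : ∀ s t, C ∩ f ⁻¹' Ioc s t ⊆ seg M f s t :=
    fun s t z hz => ⟨hC.subset_ground hz.1, hz.2⟩
  have hbound : ∀ s t, s < t → t ≤ n → (∃ x ∈ C, f x ∉ Ioc s t) →
      ((C ∩ f ⁻¹' Ioc s t).ncard : ℤ) ≤ q t - p s := by
    rintro s t hst htn ⟨x, hx, hxst⟩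
    refine H.ncard_le hst htn (hC.ssubset_indep ⟨inter_subset_left, fun h => ?_⟩) (hsub s t)
    exact hxst (h hx).2
  have hall : C ∩ f ⁻¹' Ioc 0 n = C := inter_eq_left.2 fun x hx =>
    ⟨H.one_le (hC.subset_ground hx), H.le_n (hC.subset_ground hx)⟩
  have hsplit1 := ncard_inter_Ioc_add f hCfin (Nat.zero_le a) (show a ≤ n by omega)
  have hsplit2 := ncard_inter_Ioc_add f hCfin hab.le hb.le
  have hsplit3 := ncard_inter_Ioc_add f hCfin (Nat.zero_le a) hab.le
  have hmid : (seg M f a b ∩ C).ncard = (C ∩ f ⁻¹' Ioc a b).ncard := by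
    congr 1
    ext x
    exact ⟨fun h => ⟨h.2, h.1.2⟩, fun h => ⟨⟨hC.subset_ground h.1, h.2⟩, h.1⟩⟩
  rw [hall] at hsplit1
  have hqb := h.q_north.resolve_left hb.ne
  have hqn := H.q_mono (show b + 1 ≤ n from hb) le_rfl
  have hpa := h.p_north.resolve_left ha.ne'
  have hpn := H.p_mono (Nat.zero_le (a - 1)) (by omega)
  have hp0 := H.p_zero
  by_cases hr : ∃ x ∈ C, b < f x
  · obtain ⟨x, hx, hbx⟩ := hr
    have h3 := hbound 0 b (by omega) hb.le ⟨x, hx, fun h => by have := h.2; omega⟩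
    by_cases hl : ∃ x ∈ C, f x ≤ a
    · obtain ⟨y, hy, hya⟩ := hl
      have h4 := hbound a n (by omega) le_rfl ⟨y, hy, fun h => by have := h.1; omega⟩
      omega
    · push Not at hl
      obtain ⟨y, hy⟩ := hC.nonempty
      have h4 := H.ncard_le (a := a) (b := n) (by omega) le_rfl (hC.sdiff_singleton_indep hy)
        fun z hz => ⟨hC.subset_ground hz.1, hl z hz.1, H.le_n (hC.subset_ground hz.1)⟩
      rw [ncard_diff_singleton_cast hCfin hy] at h4
      omega
  · push Not at hr
    obtain ⟨y, hy⟩ := hC.nonempty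
    have h4 := H.ncard_le (a := 0) (b := b) (by omega) hb.le (hC.sdiff_singleton_indep hy)
      fun z hz => ⟨hC.subset_ground hz.1, H.one_le (hC.subset_ground hz.1), hr z hz.1⟩
    rw [ncard_diff_singleton_cast hCfin hy] at h4
    omega

lemma Corners.isFundamentalFlat_initial {k : ℕ} (h : Corners n p q 0 k) (H : PathRep M f n p q)
    (hM : IsConnected M) (hk : k < n) : IsFundamentalFlat M (seg M f 0 k) := by
  have := H.finite
  have hk0 := h.lt
  have hq0 := H.q_zero
  have hp0 := H.p_zero
  have hqk := h.q_north.resolve_left hk.ne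
  have hrk := H.rk_seg hk0 hk.le h.dep.le
  have hq1 := H.p_lt_q hM (k := n - 1) (by omega) (by omega)
  have hp1 := H.p_step (n - 1) (by omega)
  have hqn := H.q_step (n - 1) (by omega)
  rw [Nat.sub_add_cancel (by omega)] at hp1 hqn
  have hlast := H.last
  -- The upper path ends with an East step because the paths differ at `n - 1`; making that step
  -- North gives a spanning circuit agreeing with the upper path on the window.
  let w : ℕ → ℤ := fun k => if k < n then q k else q n + 1
  have hw : ∀ k, 0 ≤ k → k < n → w k ≤ w (k + 1) ∧ w (k + 1) ≤ w k + 1 := by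
    intro k _ hk
    simp only [w]
    rw [if_pos hk]
    split_ifs with hk'
    · exact H.q_step k hk
    · obtain rfl : k = n - 1 := by omega
      omega
  obtain ⟨hC, hCs⟩ := H.isCircuit_norths (w := w) (by omega) hw (by simp [w]; omega) (by simp [w])
    (fun k h1 h2 => by
      have := H.p_lt_q hM h1 h2
      simp only [w, if_pos h2]
      omega)
    (fun k h1 h2 => by simp only [w, if_pos h2]; omega)
  refine ⟨h.isConnectedFlat H hM, h.one_lt_ncard H hM (Or.inr hk), ?_, _, hC, hCs, ?_⟩
  · rw [hrk, H.rk_ground]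
    have := H.q_mono (show k + 1 ≤ n from hk) le_rfl
    omega
  · have heq : seg M f 0 k ∩ norths M f 0 n w = norths M f 0 n w ∩ f ⁻¹' Ioc 0 k := by
      ext x
      refine ⟨fun hx => ⟨hx.2, hx.1.2⟩, fun hx => ⟨⟨hx.1.1.1, hx.2⟩, hx.1⟩⟩
    have hcard := H.ncard_norths_inter le_rfl hw (Nat.zero_le 0) hk0.le hk.le
    rw [show w k = q k from if_pos hk, show w 0 = q 0 from if_pos (by omega)] at hcard
    rw [heq]
    refine isBasis_of_indep_of_ncard_ge (hC.ssubset_indep ⟨inter_subset_left, fun hsub => ?_⟩)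
      (fun x hx => ⟨hx.1.1.1, hx.2⟩) (seg_subset_ground ..) fun J hJs hJ => ?_
    · obtain ⟨x, hx, hxn⟩ := H.exists_apply_eq (k := n) (by omega) le_rfl
      have hxC : x ∈ norths M f 0 n w := by
        refine ⟨⟨hx, by omega, by omega⟩, ?_⟩
        simp only [w, hxn, lt_irrefl, if_false, if_pos (show n - 1 < n by omega)]
        omega
      have := (hsub hxC).2.2
      omega
    · have := H.ncard_le hk0 hk.le hJ hJs
      omega

lemma Corners.isFundamentalFlat_final {k : ℕ} (h : Corners n p q k n) (H : PathRep M f n p q)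
    (hM : IsConnected M) (hk : 0 < k) : IsFundamentalFlat M (seg M f k n) := by
  have := H.finite
  have hkn := h.lt
  have hq0 := H.q_zero
  have hp0 := H.p_zero
  have hpk := h.p_north.resolve_left hk.ne'
  have hpk' := H.p_mono (Nat.zero_le (k - 1)) (by omega)
  have hrk := H.rk_seg hkn le_rfl h.dep.le
  have hq1 := H.p_lt_q hM (k := 1) (by omega) (by omega)
  have hp1 := H.p_step 0 (by omega)
  have hqn := H.q_step 0 (by omega)
  rw [Nat.zero_add] at hp1 hqn
  have hlast := H.last
  -- Dually, the lower path starts with an East step, which is made North.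
  let w : ℕ → ℤ := fun k => if 0 < k then p k + 1 else 0
  have hw : ∀ k, 0 ≤ k → k < n → w k ≤ w (k + 1) ∧ w (k + 1) ≤ w k + 1 := by
    intro k _ hk
    simp only [w]
    rw [if_pos (Nat.succ_pos k)]
    have := H.p_step k hk
    split_ifs with hk'
    · omega
    · obtain rfl : k = 0 := by omega
      rw [Nat.zero_add]
      omega
  obtain ⟨hC, hCs⟩ := H.isCircuit_norths (w := w) (by omega) hw (by simp [w])
    (by simp only [w]; rw [if_pos (by omega)]; omega)
    (fun k h1 h2 => by simp only [w, if_pos h1]; omega)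
    (fun k h1 h2 => by
      have := H.p_lt_q hM h1 h2
      simp only [w, if_pos h1]
      omega)
  refine ⟨h.isConnectedFlat H hM, h.one_lt_ncard H hM (Or.inl hk), ?_, _, hC, hCs, ?_⟩
  · rw [hrk, H.rk_ground]
    omega
  · have heq : seg M f k n ∩ norths M f 0 n w = norths M f 0 n w ∩ f ⁻¹' Ioc k n := by
      ext x
      refine ⟨fun hx => ⟨hx.2, hx.1.2⟩, fun hx => ⟨⟨hx.1.1.1, hx.2⟩, hx.1⟩⟩
    have hcard := H.ncard_norths_inter le_rfl hw (Nat.zero_le k) hkn.le le_rfl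
    rw [show w k = p k + 1 from if_pos hk, show w n = p n + 1 from if_pos (by omega)] at hcard
    rw [heq]
    refine isBasis_of_indep_of_ncard_ge (hC.ssubset_indep ⟨inter_subset_left, fun hsub => ?_⟩)
      (fun x hx => ⟨hx.1.1.1, hx.2⟩) (seg_subset_ground ..) fun J hJs hJ => ?_
    · obtain ⟨x, hx, hxn⟩ := H.exists_apply_eq (k := 1) le_rfl (by omega)
      have hxC : x ∈ norths M f 0 n w := by
        refine ⟨⟨hx, by omega, by omega⟩, ?_⟩
        simp only [w, hxn, Nat.sub_self, lt_irrefl, if_false, if_pos Nat.one_pos]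
        omega
      have := (hsub hxC).2.1
      omega
    · have := H.ncard_le hkn le_rfl hJ hJs
      omega

lemma isFundamentalFlat_iff (H : PathRep M f n p q) (hM : IsConnected M) {X : Set α} :
    IsFundamentalFlat M X ↔ (∃ k < n, Corners n p q 0 k ∧ X = seg M f 0 k) ∨
      ∃ k > 0, Corners n p q k n ∧ X = seg M f k n := by
  constructor
  · intro hX
    obtain ⟨a, b, hab, rfl⟩ := H.exists_corners hX.1 hX.2.1
    have hb := hab.le
    rcases Nat.eq_zero_or_pos a with rfl | ha
    · refine Or.inl ⟨b, lt_of_le_of_ne hb ?_, hab, rfl⟩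
      rintro rfl
      have := hX.2.2.1
      rw [H.seg_zero_n] at this
      exact lt_irrefl _ this
    · rcases eq_or_lt_of_le hb with rfl | hb
      · exact Or.inr ⟨a, ha, hab, rfl⟩
      · exact (hab.not_isFundamentalFlat H ha hb hX).elim
  · rintro (⟨k, hk, h, rfl⟩ | ⟨k, hk, h, rfl⟩)
    · exact h.isFundamentalFlat_initial H hM hk
    · exact h.isFundamentalFlat_final H hM hk

/-- The corner conditions at the two ends are independent of each other, and those at 0 and `n` hold
automatically. Only dependence of the common window is an extra requirement. -/
lemma corners_iff (H : PathRep M f n p q) (hM : IsConnected M) {a b : ℕ} (ha : 0 < a) (hb : b < n) :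
    Corners n p q a b ↔
      Corners n p q 0 b ∧ Corners n p q a n ∧ a < b ∧ q b - p a < b - a := by
  constructor
  · intro h
    have hab := h.lt
    have h1 := H.p_lt_q hM (k := 1) (by omega) (by omega)
    have h2 := H.p_lt_q hM (k := n - 1) (by omega) (by omega)
    have hp := H.p_step 0 (by omega)
    have hq := H.q_step 0 (by omega)
    have hp' := H.p_step (n - 1) (by omega)
    have hq' := H.q_step (n - 1) (by omega)
    rw [Nat.zero_add] at hp hq
    rw [Nat.sub_add_cancel (by omega)] at hp' hq'
    have hp0 := H.p_zero
    have hq0 := H.q_zero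
    have hl := H.last
    have h3 := H.q_le_add (Nat.zero_le (b - 1)) (by omega)
    have h4 := H.p_le_add (show a + 1 ≤ n by omega) le_rfl
    have h5 := h.q_east
    have h6 := h.p_east
    refine ⟨⟨by omega, hb.le, by rw [Nat.zero_add]; omega, h5, Or.inl rfl, h.q_north, by omega⟩,
      ⟨by omega, le_rfl, h6, by omega, h.p_north, Or.inl rfl, by omega⟩, hab, h.dep⟩
  · rintro ⟨h1, h2, hab, hdep⟩
    exact ⟨hab, hb.le, h2.p_east, h1.q_east, h2.p_north, h1.q_north, hdep⟩

lemma seg_inter_seg (H : PathRep M f n p q) {a b : ℕ} :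
    seg M f 0 b ∩ seg M f a n = seg M f a b := by
  ext x
  simp only [mem_inter_iff, mem_seg]
  constructor
  · rintro ⟨⟨h1, h2, h3⟩, h4, h5, h6⟩
    exact ⟨h1, h5, h3⟩
  · rintro ⟨h1, h2, h3⟩
    exact ⟨⟨h1, by omega, h3⟩, h1, h2, H.le_n h1⟩

lemma seg_zero_ssubset (H : PathRep M f n p q) {s t : ℕ} (hst : s < t) (ht : t ≤ n) :
    seg M f 0 s ⊂ seg M f 0 t := by
  refine ⟨fun x hx => ⟨hx.1, hx.2.1, hx.2.2.trans hst.le⟩, fun hsub => ?_⟩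
  obtain ⟨x, hx, hxt⟩ := H.exists_apply_eq (k := t) (by omega) ht
  have := (hsub (a := x) ⟨hx, by simp only [mem_preimage, mem_Ioc]; omega⟩).2.2
  omega

lemma seg_n_ssubset (H : PathRep M f n p q) {s t : ℕ} (hst : s < t) (ht : t ≤ n) :
    seg M f t n ⊂ seg M f s n := by
  refine ⟨fun x hx => ⟨hx.1, hst.trans hx.2.1, hx.2.2⟩, fun hsub => ?_⟩
  obtain ⟨x, hx, hxt⟩ := H.exists_apply_eq (k := t) (by omega) ht
  have := (hsub (a := x) ⟨hx, by simp only [mem_preimage, mem_Ioc]; omega⟩).2.1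
  omega

/-- The fundamental flats of a connected lattice path matroid come from the corners of the two
bounding paths, and the other proper nontrivial connected flats are intersections of these. -/
theorem exists_chains (H : PathRep M f n p q) (hM : IsConnected M) :
    ∃ (h k : ℕ) (F : Fin h → Set α) (G : Fin k → Set α),
      (StrictMono F ∧ StrictMono G ∧ Disjoint (Set.range F) (Set.range G) ∧
        ∀ X, IsFundamentalFlat M X ↔ X ∈ Set.range F ∪ Set.range G) ∧
      (∀ i j, (F i ∩ G j).Nonempty → F i ∪ G j = M.E) ∧
      (∀ X, IsProperNontrivialConnectedFlat M X ↔
        (∃ i, X = F i) ∨ (∃ j, X = G j) ∨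
        ∃ i j, X = F i ∩ G j ∧ nullity M M.E < nullity M (F i) + nullity M (G j)) ∧
      (∀ i j, nullity M M.E < nullity M (F i) + nullity M (G j) →
        rk M (F i ∩ G j) = rk M (F i) + rk M (G j) - rk M M.E) := by
  classical
  let KQ : Finset ℕ := {k ∈ Finset.range n | Corners n p q 0 k}
  let KP : Finset ℕ := {k ∈ Finset.range n | 0 < k ∧ Corners n p q k n}
  let u := KQ.orderEmbOfFin rfl
  let v := KP.orderEmbOfFin rfl
  have hu : ∀ i, u i < n ∧ Corners n p q 0 (u i) := fun i => by
    have h := Finset.mem_filter.1 (KQ.orderEmbOfFin_mem rfl i)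
    exact ⟨Finset.mem_range.1 h.1, h.2⟩
  have hv : ∀ j, v j < n ∧ 0 < v j ∧ Corners n p q (v j) n := fun j => by
    have h := Finset.mem_filter.1 (KP.orderEmbOfFin_mem rfl j)
    exact ⟨Finset.mem_range.1 h.1, h.2⟩
  have hu' : ∀ k < n, Corners n p q 0 k → ∃ i, u i = k := fun k hk h => by
    have : k ∈ Set.range u := by
      rw [Finset.range_orderEmbOfFin]
      simp [KQ, hk, h]
    exact this
  have hv' : ∀ k > 0, Corners n p q k n → ∃ j, v (Fin.rev j) = k := fun k hk h => by
    have : k ∈ Set.range v := by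
      rw [Finset.range_orderEmbOfFin]
      simp [KP, hk, h, h.lt]
    obtain ⟨j, hj⟩ := this
    exact ⟨Fin.rev j, by rw [Fin.rev_rev, hj]⟩
  have hF : ∀ i, rk M (seg M f 0 (u i)) = q (u i) := fun i => by
    obtain ⟨h1, h2⟩ := hu i
    rw [H.rk_seg h2.lt h1.le h2.dep.le, H.p_zero, sub_zero]
  have hG : ∀ j, rk M (seg M f (v j) n) = q n - p (v j) := fun j => by
    obtain ⟨h1, -, h2⟩ := hv j
    exact H.rk_seg h1 le_rfl h2.dep.le
  -- After cancellation the nullity inequality is `dep` for the common window. It already forces the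
  -- window to be nonempty, since `p` climbs by at most one per step and lies below `q`.
  have hnull : ∀ i j, nullity M M.E < nullity M (seg M f 0 (u i)) + nullity M (seg M f (v j) n) ↔
      v j < u i ∧ q (u i) - p (v j) < u i - v j := by
    intro i j
    obtain ⟨h1, h2⟩ := hu i
    obtain ⟨h3, h4, h5⟩ := hv j
    have c1 := H.ncard_seg (Nat.zero_le (u i)) h1.le
    have c2 := H.ncard_seg h3.le le_rfl
    have c3 := H.ncard_seg (Nat.zero_le n) le_rfl
    rw [H.seg_zero_n] at c3
    simp only [nullity, hF, hG, H.rk_ground, c1, c2, c3]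
    constructor
    · intro hlt
      refine ⟨?_, by push_cast at hlt; omega⟩
      by_contra! hle
      have := H.p_le_add hle h3.le
      have := H.le (u i) h1.le
      push_cast at hlt
      omega
    · rintro ⟨h6, h7⟩
      push_cast
      omega
  -- Final segments shrink as their left end grows, so the second chain is indexed in reverse.
  refine ⟨KQ.card, KP.card, fun i => seg M f 0 (u i), fun j => seg M f (v (Fin.rev j)) n,
    ⟨fun i j hij => ?_, fun i j hij => ?_, ?_, fun X => ?_⟩, ?_, fun X => ?_, ?_⟩
  · exact H.seg_zero_ssubset (u.strictMono hij) (hu j).1.le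
  · exact H.seg_n_ssubset (v.strictMono (Fin.rev_lt_rev.2 hij)) (hv _).1.le
  · rw [Set.disjoint_left]
    rintro _ ⟨i, rfl⟩ ⟨j, hj⟩
    obtain ⟨x, hx, hxn⟩ := H.exists_apply_eq (k := n) (by have := (hu i).1; omega) le_rfl
    have hxG : x ∈ seg M f (v (Fin.rev j)) n := ⟨hx, by rw [hxn]; exact (hv _).1, hxn.le⟩
    have hxF : x ∈ seg M f 0 (u i) := by
      rwa [← show seg M f (v (Fin.rev j)) n = seg M f 0 (u i) from hj]
    have := hxF.2.2
    have := (hu i).1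
    omega
  · rw [H.isFundamentalFlat_iff hM]
    simp only [mem_union, mem_range]
    refine or_congr ⟨?_, ?_⟩ ⟨?_, ?_⟩
    · rintro ⟨k, hk, h, rfl⟩
      obtain ⟨i, rfl⟩ := hu' k hk h
      exact ⟨i, rfl⟩
    · rintro ⟨i, rfl⟩
      exact ⟨u i, (hu i).1, (hu i).2, rfl⟩
    · rintro ⟨k, hk, h, rfl⟩
      obtain ⟨j, rfl⟩ := hv' k hk h
      exact ⟨j, rfl⟩
    · rintro ⟨j, rfl⟩
      exact ⟨_, (hv _).2.1, (hv _).2.2, rfl⟩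
  · rintro i j ⟨x, hx1, hx2⟩
    refine subset_antisymm (union_subset (seg_subset_ground ..) (seg_subset_ground ..)) ?_
    intro y hy
    have h1 := hx1.2.2
    have h2 := hx2.2.1
    have h3 := H.one_le hy
    have h4 := H.le_n hy
    rcases le_or_gt (f y) (u i) with h | h
    · exact Or.inl ⟨hy, h3, h⟩
    · exact Or.inr ⟨hy, by omega, h4⟩
  · rw [H.isProperNontrivialConnectedFlat_iff hM]
    simp only [hnull, H.seg_inter_seg]
    constructor
    · rintro ⟨a, b, h, rfl, hne⟩
      have hb := h.le
      rcases Nat.eq_zero_or_pos a with rfl | ha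
      · obtain ⟨i, rfl⟩ := hu' b (by omega) h
        exact Or.inl ⟨i, rfl⟩
      rcases eq_or_lt_of_le hb with rfl | hb
      · obtain ⟨j, rfl⟩ := hv' a ha h
        exact Or.inr (Or.inl ⟨j, rfl⟩)
      · obtain ⟨h1, h2, h3⟩ := (H.corners_iff hM ha hb).1 h
        obtain ⟨i, rfl⟩ := hu' b hb h1
        obtain ⟨j, rfl⟩ := hv' a ha h2
        exact Or.inr (Or.inr ⟨i, j, rfl, h3⟩)
    · rintro (⟨i, rfl⟩ | ⟨j, rfl⟩ | ⟨i, j, rfl, h⟩)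
      · exact ⟨0, u i, (hu i).2, rfl, Or.inr (hu i).1⟩
      · exact ⟨_, n, (hv _).2.2, rfl, Or.inl (hv _).2.1⟩
      · exact ⟨_, u i, (H.corners_iff hM (hv _).2.1 (hu i).1).2 ⟨(hu i).2, (hv _).2.2, h⟩, rfl,
          Or.inr (hu i).1⟩
  · intro i j hij
    obtain ⟨h1, h2⟩ := (hnull i (Fin.rev j)).1 hij
    rw [H.seg_inter_seg, hF, hG, H.rk_ground, H.rk_seg h1 (hu i).1.le h2.le]
    omega

end PathRep

/-! ### Circuits, closures and connectedness in general matroids. -/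

section Connectivity

variable {M : Matroid α}

/-- Lying in a common circuit is a transitive relation. -/
lemma exists_isCircuit_of_inter_nonempty {C₁ C₂ : Set α} {e g : α} (h₁ : M.IsCircuit C₁)
    (h₂ : M.IsCircuit C₂) (hfin : (C₁ ∪ C₂).Finite) (he : e ∈ C₁) (hg : g ∈ C₂)
    (hne : (C₁ ∩ C₂).Nonempty) : ∃ C ⊆ C₁ ∪ C₂, M.IsCircuit C ∧ e ∈ C ∧ g ∈ C := by
  induction hN : (C₁ ∪ C₂).ncard using Nat.strong_induction_on generalizing C₁ C₂ with
  | _ N ih =>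
    by_cases he₂ : e ∈ C₂
    · exact ⟨C₂, subset_union_right, h₂, he₂, hg⟩
    by_cases hg₁ : g ∈ C₁
    · exact ⟨C₁, subset_union_left, h₁, he, hg₁⟩
    obtain ⟨x, hx₁, hx₂⟩ := hne
    -- Induction on the size of the union. If `C₃` contains some element of `C₄` outside `C₂`, then
    -- `C₃` and `C₄` meet and their union misses `x`; otherwise `C₃` and `C₂` meet and their union
    -- misses such an element.
    obtain ⟨C₃, h₃s, h₃, he₃⟩ := h₁.strong_elimination h₂ hx₁ hx₂ he he₂
    obtain ⟨C₄, h₄s, h₄, hg₄⟩ := h₂.strong_elimination h₁ hx₂ hx₁ hg hg₁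
    rw [union_comm] at h₄s
    have h₃' := h₃s.trans sdiff_subset
    have h₄' := h₄s.trans sdiff_subset
    have smaller : ∀ {D₁ D₂ : Set α}, M.IsCircuit D₁ → M.IsCircuit D₂ → D₁ ∪ D₂ ⊂ C₁ ∪ C₂ →
        e ∈ D₁ → g ∈ D₂ → (D₁ ∩ D₂).Nonempty →
        ∃ C ⊆ C₁ ∪ C₂, M.IsCircuit C ∧ e ∈ C ∧ g ∈ C := by
      intro D₁ D₂ hD₁ hD₂ hD heD hgD hDne
      obtain ⟨C, hCs, hC⟩ := ih _ (hN ▸ ncard_lt_ncard hD hfin) hD₁ hD₂ (hfin.subset hD.subset)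
        heD hgD hDne rfl
      exact ⟨C, hCs.trans hD.subset, hC⟩
    obtain ⟨y, hy₃, hy₁⟩ : ∃ y ∈ C₃, y ∉ C₁ := by
      by_contra! hc
      have := h₁.eq_of_superset_isCircuit h₃ hc
      exact (h₃s (this ▸ hx₁)).2 rfl
    obtain ⟨z, hz₄, hz₂⟩ : ∃ z ∈ C₄, z ∉ C₂ := by
      by_contra! hc
      have := h₂.eq_of_superset_isCircuit h₄ hc
      exact (h₄s (this ▸ hx₂)).2 rfl
    by_cases hz₃ : z ∈ C₃
    · exact smaller h₃ h₄ ⟨union_subset h₃' h₄', fun hs =>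
        (union_subset h₃s h₄s (hs (Or.inl hx₁))).2 rfl⟩ he₃ hg₄ ⟨z, hz₃, hz₄⟩
    · refine smaller h₃ h₂ ⟨union_subset h₃' subset_union_right, fun hs => ?_⟩ he₃ hg
        ⟨y, hy₃, (h₃' hy₃).resolve_left hy₁⟩
      rcases hs (h₄' hz₄) with h | h
      · exact hz₃ h
      · exact hz₂ h

/-- Every element of the closure lies in a circuit meeting `C`, as it is not a loop; transitivity
through `C` does the rest. -/
lemma isConnected_restrict_closure [M.Finite] {C : Set α} (hC : M.IsCircuit C)
    (hloop : ∀ x ∈ M.closure C, M.Indep {x}) : IsConnected (M.restrict (M.closure C)) := by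
  have hsub := M.closure_subset_ground C
  have hCcl := M.subset_closure C hC.subset_ground
  have hfin : ∀ X ⊆ M.E, X.Finite := fun X hX => M.ground_finite.subset hX
  have key : ∀ x ∈ M.closure C, ∃ D ⊆ M.closure C, M.IsCircuit D ∧ x ∈ D ∧ (D ∩ C).Nonempty := by
    intro x hx
    by_cases hxC : x ∈ C
    · exact ⟨C, hCcl, hC, hxC, x, hxC, hxC⟩
    obtain ⟨D, hDs, hD, hxD⟩ := exists_isCircuit_of_mem_closure hx hxC
    refine ⟨D, hDs.trans (insert_subset hx hCcl), hD, hxD, ?_⟩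
    by_contra hne
    refine hD.not_indep ((hloop x hx).subset fun y hy => ?_)
    exact (hDs hy).resolve_right fun hyC => hne ⟨y, hy, hyC⟩
  intro x hx y hy _
  rw [restrict_ground_eq] at hx hy
  obtain ⟨D, hDs, hD, hxD, z, hzD, hzC⟩ := key x hx
  obtain ⟨D', hDs', hD', hyD', z', hzD', hzC'⟩ := key y hy
  obtain ⟨D₁, hDs₁, hD₁, hx₁, hz₁⟩ := exists_isCircuit_of_inter_nonempty hD hC
    (hfin _ (union_subset hD.subset_ground hC.subset_ground)) hxD hzC' ⟨z, hzD, hzC⟩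
  obtain ⟨D₂, hDs₂, hD₂, hx₂, hy₂⟩ := exists_isCircuit_of_inter_nonempty hD₁ hD'
    (hfin _ (union_subset hD₁.subset_ground hD'.subset_ground)) hx₁ hyD' ⟨z', hz₁, hzD'⟩
  refine ⟨D₂, (restrict_isCircuit_iff hsub).2 ⟨hD₂, ?_⟩, hx₂, hy₂⟩
  exact hDs₂.trans (union_subset (hDs₁.trans (union_subset hDs hCcl)) hDs')

lemma indep_singleton_of_isConnected (hM : IsConnected M) {x y : α} (hx : x ∈ M.E) (hy : y ∈ M.E)
    (hxy : x ≠ y) : M.Indep {x} := by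
  obtain ⟨C, hC, hxC, hyC⟩ := hM x hx y hy hxy
  exact hC.ssubset_indep ⟨singleton_subset_iff.2 hxC, fun h => hxy (h hyC).symm⟩

/-- In a connected matroid, a set is independent unless a proper nontrivial connected flat or the
ground set meets it in more elements than its rank. -/
lemma indep_of_forall_ncard_le [M.Finite] (hM : IsConnected M) {I : Set α} (hI : I ⊆ M.E)
    (hE : (I.ncard : ℤ) ≤ rk M M.E)
    (h : ∀ X, IsProperNontrivialConnectedFlat M X → ((I ∩ X).ncard : ℤ) ≤ rk M X) : M.Indep I := by
  by_contra hdep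
  have hIfin := finite_of_subset_ground hI
  -- The closure of `C` contains one more element of `C` than its rank, and it is either the ground
  -- set or a proper nontrivial connected flat.
  obtain ⟨C, hCI, hC⟩ := ((not_indep_iff hI).1 hdep).exists_isCircuit_subset
  have hcard : (C.ncard : ℤ) = rk M (M.closure C) + 1 := by
    have hrk : rk M (M.closure C) = rk M C := by rw [rk, eRk_closure_eq, rk]
    obtain ⟨x, hx⟩ := hC.nonempty
    rw [hrk, rk_eq_of_isBasis (hC.sdiff_singleton_isBasis hx)]
    have := ncard_sdiff_singleton_add_one hx (hIfin.subset hCI)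
    omega
  have hCcl := M.subset_closure C hC.subset_ground
  by_cases heq : M.closure C = M.E
  · rw [heq] at hcard
    have := ncard_le_ncard hCI hIfin
    omega
  · have hX : IsProperNontrivialConnectedFlat M (M.closure C) := by
      refine ⟨⟨M.isFlat_closure C, isConnected_restrict_closure hC fun x hx => ?_⟩, heq,
        fun hi => hC.not_indep (hi.subset hCcl)⟩
      obtain ⟨y, hy, hyC⟩ := exists_of_ssubset ((M.closure_subset_ground C).ssubset_of_ne heq)
      exact indep_singleton_of_isConnected hM (M.closure_subset_ground C hx) hy
        (by rintro rfl; exact hyC hx)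
    have := h _ hX
    have := ncard_le_ncard (subset_inter hCI hCcl) (hIfin.subset inter_subset_left)
    omega

end Connectivity

/-! ### Numbering the ground set along a chain. -/

/-- A finite set can be numbered so that the values of a given function are increasing. -/
lemma exists_bijOn_Icc_monotone {E : Set α} (hE : E.Finite) (c : α → ℕ) :
    ∃ f : α → ℕ, BijOn f E (Icc 1 E.ncard) ∧ ∀ x ∈ E, ∀ y ∈ E, c x < c y → f x < f y := by
  classical
  induction hn : E.ncard generalizing E with
  | zero =>
    rw [ncard_eq_zero hE] at hn
    subst hn
    exact ⟨fun _ => 0, by simp, by simp⟩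
  | succ n ih =>
    have hne : E.Nonempty := by
      rw [← ncard_pos hE]
      omega
    obtain ⟨z, hz, hmax⟩ := exists_max_image E c hE hne
    have hcard := ncard_sdiff_singleton_add_one hz hE
    obtain ⟨f, hf, hmono⟩ := ih (E := E \ {z}) (hE.subset sdiff_subset) (by omega)
    have hval : ∀ x ∈ E, x ≠ z → Function.update f z (n + 1) x = f x ∧ 1 ≤ f x ∧ f x ≤ n :=
      fun x hx hxz => ⟨Function.update_of_ne hxz _ _, hf.mapsTo ⟨hx, hxz⟩⟩
    refine ⟨Function.update f z (n + 1), ⟨fun x hx => ?_, fun x hx y hy hxy => ?_, ?_⟩, ?_⟩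
    · by_cases hxz : x = z
      · subst hxz
        simp
      · obtain ⟨h1, h2, h3⟩ := hval x hx hxz
        rw [h1]
        exact ⟨h2, by omega⟩
    · by_cases hxz : x = z <;> by_cases hyz : y = z
      · rw [hxz, hyz]
      · subst hxz
        obtain ⟨h1, h2, h3⟩ := hval y hy hyz
        rw [h1, Function.update_self] at hxy
        omega
      · subst hyz
        obtain ⟨h1, h2, h3⟩ := hval x hx hxz
        rw [h1, Function.update_self] at hxy
        omega
      · rw [(hval x hx hxz).1, (hval y hy hyz).1] at hxy
        exact hf.injOn ⟨hx, hxz⟩ ⟨hy, hyz⟩ hxy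
    · rintro k ⟨hk1, hk2⟩
      rcases eq_or_lt_of_le hk2 with rfl | hk2
      · exact ⟨z, hz, Function.update_self ..⟩
      · obtain ⟨x, ⟨hx, hxz⟩, rfl⟩ := hf.surjOn (show k ∈ Icc 1 n from ⟨hk1, by omega⟩)
        exact ⟨x, hx, (hval x hx hxz).1⟩
    · intro x hx y hy hxy
      have hxz : x ≠ z := by
        rintro rfl
        exact (hmax y hy).not_gt hxy
      obtain ⟨h1, h2, h3⟩ := hval x hx hxz
      rw [h1]
      by_cases hyz : y = z
      · subst hyz
        rw [Function.update_self]
        omega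
      · rw [(hval y hy hyz).1]
        exact hmono x ⟨hx, hxz⟩ y ⟨hy, hyz⟩ hxy

/-- A finite set can be numbered so that the members of a finite chain of subsets are initial
segments. -/
lemma exists_bijOn_Icc_initial {E : Set α} (hE : E.Finite) {S : Set (Set α)} (hS : S.Finite)
    (hchain : IsChain (· ⊆ ·) S) (hsub : ∀ X ∈ S, X ⊆ E) :
    ∃ f : α → ℕ, BijOn f E (Icc 1 E.ncard) ∧
      ∀ X ∈ S, ∃ k ≤ E.ncard, X = E ∩ f ⁻¹' Ioc 0 k := by
  -- Sorting by the number of chain members that miss an element puts each member before its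
  -- complement.
  obtain ⟨f, hf, hmono⟩ := exists_bijOn_Icc_monotone hE fun x => {X ∈ S | x ∉ X}.ncard
  refine ⟨f, hf, fun X hX => ?_⟩
  have hlt : ∀ x ∈ X, ∀ y ∈ E, y ∉ X → f x < f y := by
    intro x hx y hy hyX
    refine hmono x (hsub X hX hx) y hy (ncard_lt_ncard ⟨?_, ?_⟩ (hS.subset (sep_subset _ _)))
    · rintro Y ⟨hY, hxY⟩
      refine ⟨hY, fun hyY => ?_⟩
      rcases hchain.total hX hY with h | h
      · exact hxY (h hx)
      · exact hyX (h hyY)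
    · exact fun h => (h ⟨hX, hyX⟩ : X ∈ {X ∈ S | x ∉ X}).2 hx
  rcases X.eq_empty_or_nonempty with rfl | hne
  · exact ⟨0, Nat.zero_le _, by simp⟩
  obtain ⟨z, hz, hmax⟩ := exists_max_image X f (hE.subset (hsub X hX)) hne
  refine ⟨f z, (hf.mapsTo (hsub X hX hz)).2, subset_antisymm (fun x hx => ?_) ?_⟩
  · exact ⟨hsub X hX hx, (hf.mapsTo (hsub X hX hx)).1, hmax x hx⟩
  · rintro x ⟨hxE, hx⟩
    by_contra hxX
    exact (hlt z hz x hxE hxX).not_ge hx.2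

/-! ### From the chains back to a pair of paths. -/

open PathRep in
lemma exists_pathRep_of_chains {M : Matroid α} [M.Finite] (hM : IsConnected M) {h k : ℕ}
    {F : Fin h → Set α} {G : Fin k → Set α} (hF : Monotone F) (hG : Monotone G)
    (hFE : ∀ i, F i ⊆ M.E) (hGE : ∀ j, G j ⊆ M.E)
    (hFG : ∀ i j, (F i ∩ G j).Nonempty → F i ∪ G j = M.E)
    (hflats : ∀ X, IsProperNontrivialConnectedFlat M X →
      (∃ i, X = F i) ∨ (∃ j, X = G j) ∨
      ∃ i j, X = F i ∩ G j ∧ nullity M M.E < nullity M (F i) + nullity M (G j))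
    (hrk : ∀ i j, nullity M M.E < nullity M (F i) + nullity M (G j) →
      rk M (F i ∩ G j) = rk M (F i) + rk M (G j) - rk M M.E) :
    ∃ f n p q, PathRep M f n p q := by
  have hEfin := M.ground_finite
  have hFG' : ∀ i j, F i ⊆ M.E \ G j ∨ M.E \ G j ⊆ F i := by
    intro i j
    rcases (F i ∩ G j).eq_empty_or_nonempty with h0 | hne
    · exact Or.inl fun x hx => ⟨hFE i hx, fun hxG => (h0 ▸ ⟨hx, hxG⟩ : x ∈ (∅ : Set α))⟩
    · refine Or.inr fun x hx => ?_
      rw [← hFG i j hne] at hx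
      exact hx.1.resolve_right hx.2
  -- Condition (ii) is what makes an `F i` comparable with the complement of a `G j`.
  have hchain : IsChain (· ⊆ ·) (range F ∪ range fun j => M.E \ G j) := by
    rintro _ (⟨i, rfl⟩ | ⟨j, rfl⟩) _ (⟨i', rfl⟩ | ⟨j', rfl⟩) _
    · exact (le_total i i').imp (fun h => hF h) fun h => hF h
    · exact hFG' i j'
    · exact (hFG' i' j).symm
    · exact (le_total j' j).imp (fun h => sdiff_subset_sdiff_right (hG h))
        fun h => sdiff_subset_sdiff_right (hG h)
  obtain ⟨f, hf, hS⟩ := exists_bijOn_Icc_initial hEfin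
    ((finite_range F).union (finite_range _)) hchain (by
      rintro _ (⟨i, rfl⟩ | ⟨j, rfl⟩)
      · exact hFE i
      · exact sdiff_subset)
  set n := M.E.ncard
  have hFseg : ∀ i, ∃ b ≤ n, F i = seg M f 0 b := fun i => hS _ (Or.inl ⟨i, rfl⟩)
  have hGseg : ∀ j, ∃ a ≤ n, G j = seg M f a n := fun j => by
    obtain ⟨a, ha, heq⟩ := hS (M.E \ G j) (Or.inr ⟨j, rfl⟩)
    refine ⟨a, ha, ?_⟩
    rw [← Set.sdiff_sdiff_cancel_left (hGE j), heq]
    ext x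
    have : x ∈ M.E → 1 ≤ f x ∧ f x ≤ n := fun hx => hf.mapsTo hx
    simp only [mem_sdiff, mem_inter_iff, mem_preimage, mem_Ioc, mem_seg, not_and, not_le]
    constructor
    · rintro ⟨h1, h2⟩
      have := this h1
      exact ⟨h1, h2 h1 (by omega), by omega⟩
    · rintro ⟨h1, h2, h3⟩
      exact ⟨h1, fun _ _ => h2⟩
  have hseg0 : seg M f 0 n = M.E :=
    inter_eq_left.2 fun x hx => hf.mapsTo hx
  have hseg_self : ∀ a, seg M f a a = ∅ := fun a => by
    rw [seg, Ioc_self, preimage_empty, inter_empty]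
  have hrk_empty : rk M ∅ = 0 := by
    rw [rk_eq_of_indep M.empty_indep, ncard_empty]
    rfl
  have hrk_insert : ∀ X Y, (∃ x, Y ⊆ insert x X) → rk M Y ≤ rk M X + 1 := by
    rintro X Y ⟨x, hY⟩
    have h1 := rk_inter_add_rk_union_le M {x} X
    have h2 : rk M {x} ≤ 1 := by
      have := M.eRk_singleton_le x
      rw [← cast_rk] at this
      unfold rk
      exact_mod_cast this
    have h3 : 0 ≤ rk M ({x} ∩ X) := Int.natCast_nonneg _
    have h4 := rk_mono (M := M) hY
    rw [insert_eq] at h4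
    omega
  have hsurj : ∀ k < n, ∃ x ∈ M.E, f x = k + 1 := fun k hk => by
    obtain ⟨x, hx, hxk⟩ := hf.surjOn (show k + 1 ∈ Icc 1 n from ⟨by omega, hk⟩)
    exact ⟨x, hx, hxk⟩
  have hinter : ∀ a b, seg M f 0 b ∩ seg M f a n = seg M f a b := by
    intro a b
    ext x
    have : x ∈ M.E → 1 ≤ f x ∧ f x ≤ n := fun hx => hf.mapsTo hx
    simp only [mem_inter_iff, mem_seg]
    constructor
    · rintro ⟨⟨h1, h2, h3⟩, h4, h5, h6⟩
      exact ⟨h1, h5, h3⟩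
    · rintro ⟨h1, h2, h3⟩
      exact ⟨⟨h1, by omega, h3⟩, h1, h2, (this h1).2⟩
  have hunion : ∀ a b, a ≤ b → seg M f 0 b ∪ seg M f a n = M.E := by
    intro a b hab
    refine subset_antisymm (union_subset (seg_subset_ground ..) (seg_subset_ground ..)) ?_
    intro x hx
    have h1 := hf.mapsTo hx
    rcases le_or_gt (f x) b with h | h
    · exact Or.inl ⟨hx, h1.1, h⟩
    · exact Or.inr ⟨hx, by omega, h1.2⟩
  -- The right-hand side is the window bound `q b - p a` for the paths defined below; the case `a =
  -- b` gives `p ≤ q`.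
  have hsubmod : ∀ a b, a ≤ b →
      rk M (seg M f a b) ≤ rk M (seg M f 0 b) - (rk M M.E - rk M (seg M f a n)) := by
    intro a b hab
    have := rk_inter_add_rk_union_le M (seg M f 0 b) (seg M f a n)
    rw [hinter, hunion a b hab] at this
    omega
  refine ⟨f, n, fun a => rk M M.E - rk M (seg M f a n), fun b => rk M (seg M f 0 b), hf,
    ?_, ?_, ?_, ?_, ?_, ?_, ?_⟩
  · rw [hseg0, sub_self]
  · rw [hseg_self, hrk_empty]
  · rw [hseg_self, hrk_empty, hseg0, sub_zero]
  · intro k hk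
    have h1 : rk M (seg M f (k + 1) n) ≤ rk M (seg M f k n) :=
      rk_mono fun x hx => ⟨hx.1, by have := hx.2.1; omega, hx.2.2⟩
    have h2 := hrk_insert (seg M f (k + 1) n) (seg M f k n) (by
      obtain ⟨x, hx, hxk⟩ := hsurj k hk
      refine ⟨x, fun y hy => ?_⟩
      rcases eq_or_ne y x with rfl | hne
      · exact Or.inl rfl
      · have h3 : f y ≠ k + 1 := fun h => hne (hf.injOn hy.1 hx (h.trans hxk.symm))
        exact Or.inr ⟨hy.1, by have := hy.2.1; omega, hy.2.2⟩)
    omega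
  · intro k hk
    have h1 : rk M (seg M f 0 k) ≤ rk M (seg M f 0 (k + 1)) :=
      rk_mono fun x hx => ⟨hx.1, hx.2.1, by have := hx.2.2; omega⟩
    have h2 := hrk_insert (seg M f 0 k) (seg M f 0 (k + 1)) (by
      obtain ⟨x, hx, hxk⟩ := hsurj k hk
      refine ⟨x, fun y hy => ?_⟩
      rcases eq_or_ne y x with rfl | hne
      · exact Or.inl rfl
      · have h3 : f y ≠ k + 1 := fun h => hne (hf.injOn hy.1 hx (h.trans hxk.symm))
        exact Or.inr ⟨hy.1, hy.2.1, by have := hy.2.2; omega⟩)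
    omega
  · intro k _
    have := hsubmod k k le_rfl
    rw [hseg_self, hrk_empty] at this
    omega
  · intro I hI
    constructor
    · intro hind a b hab _
      have h1 : ((I ∩ f ⁻¹' Ioc a b).ncard : ℤ) ≤ rk M (seg M f a b) :=
        ncard_le_rk (hind.subset inter_subset_left) fun x hx => ⟨hI hx.1, hx.2⟩
      exact h1.trans (hsubmod a b hab.le)
    · intro hcond
      have hIseg : ∀ a b, I ∩ seg M f a b = I ∩ f ⁻¹' Ioc a b := fun a b => by
        rw [seg, ← inter_assoc, inter_eq_left.2 hI]
      -- The maximum with 0 covers empty windows, since `F i` and `G j` are not yet known to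
      -- overlap; by (iv) the bound is a rank when it is used, so the maximum disappears.
      have hcond' : ∀ a b, b ≤ n → ((I ∩ seg M f a b).ncard : ℤ) ≤
          max 0 (rk M (seg M f 0 b) - (rk M M.E - rk M (seg M f a n))) := by
        intro a b hb
        rcases lt_or_ge a b with hab | hab
        · rw [hIseg]
          exact (hcond a b hab hb).trans (le_max_right _ _)
        · rw [seg, Ioc_eq_empty (by omega), preimage_empty, inter_empty, inter_empty, ncard_empty]
          exact le_max_left _ _
      have hnonneg : ∀ X, 0 ≤ rk M X := fun X => Int.natCast_nonneg _
      refine indep_of_forall_ncard_le hM hI ?_ fun X hX => ?_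
      · have := hcond' 0 n le_rfl
        rw [hseg0, inter_eq_left.2 hI, sub_self, sub_zero, max_eq_right (hnonneg _)] at this
        exact this
      · rcases hflats X hX with ⟨i, rfl⟩ | ⟨j, rfl⟩ | ⟨i, j, rfl, hij⟩
        · obtain ⟨b, hb, heq⟩ := hFseg i
          have := hcond' 0 b hb
          rw [hseg0, sub_self, sub_zero, max_eq_right (hnonneg _)] at this
          rwa [heq]
        · obtain ⟨a, ha, heq⟩ := hGseg j
          have := hcond' a n le_rfl
          rw [hseg0, sub_sub_cancel, max_eq_right (hnonneg _)] at this
          rwa [heq]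
        · obtain ⟨b, hb, heqF⟩ := hFseg i
          obtain ⟨a, ha, heqG⟩ := hGseg j
          have h1 := hrk i j hij
          have h2 := hcond' a b hb
          have h3 := hnonneg (F i ∩ G j)
          rw [heqF, heqG, hinter] at h1 h3 ⊢
          omega

end LPM

theorem theorem5p8 {α : Type*} (M : Matroid α) [M.Finite] (hM : LPM.IsConnected M) :
    LPM.IsLatticePathMatroid M ↔
      ∃ (h k : ℕ) (F : Fin h → Set α) (G : Fin k → Set α),
        -- (i) the fundamental flats form at most two disjoint chains
        (StrictMono F ∧ StrictMono G ∧ Disjoint (Set.range F) (Set.range G) ∧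
          ∀ X, LPM.IsFundamentalFlat M X ↔ X ∈ Set.range F ∪ Set.range G) ∧
        -- (ii)
        (∀ i j, (F i ∩ G j).Nonempty → F i ∪ G j = M.E) ∧
        -- (iii) the proper nontrivial connected flats
        (∀ X, LPM.IsProperNontrivialConnectedFlat M X ↔
          (∃ i, X = F i) ∨ (∃ j, X = G j) ∨
          ∃ i j, X = F i ∩ G j ∧
            LPM.nullity M M.E < LPM.nullity M (F i) + LPM.nullity M (G j)) ∧
        -- (iv) the ranks of the intersections in (iii)
        (∀ i j, LPM.nullity M M.E < LPM.nullity M (F i) + LPM.nullity M (G j) →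
          LPM.rk M (F i ∩ G j) = LPM.rk M (F i) + LPM.rk M (G j) - LPM.rk M M.E) := by
  constructor
  · intro h
    obtain ⟨f, n, p, q, H⟩ := h.exists_pathRep
    exact H.exists_chains hM
  · rintro ⟨h, k, F, G, ⟨hF, hG, -, hfund⟩, hFG, hflats, hrk⟩
    have hsub : ∀ X, LPM.IsFundamentalFlat M X → X ⊆ M.E := fun X hX => hX.1.1.subset_ground
    obtain ⟨f, n, p, q, H⟩ := LPM.exists_pathRep_of_chains hM hF.monotone hG.monotone
      (fun i => hsub _ ((hfund _).2 (Or.inl ⟨i, rfl⟩)))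
      (fun j => hsub _ ((hfund _).2 (Or.inr ⟨j, rfl⟩))) hFG (fun X hX => (hflats X).1 hX) hrk
    exact H.isLatticePathMatroid
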